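/- Let $0<q<1$, $\lambda>0$, $\eta\in\mathbb R$, $b=\lambda-i\eta$ and $\eta_q=\eta\ln q$. Write $(a;q)_n=\prod_{i=0}^{n-1}(1-aq^i)$, $(a;q)_\infty=\prod_{i\ge0}(1-aq^i)$, and $${}_2\phi_1(a,b;c;q,z)=\sum_{n\ge0}\frac{(a;q)_n(b;q)_n}{(c;q)_n(q;q)_n}z^n$$ (terminated after $n=k$ if $a=q^{-k}$). For $k\ge 0$ let $$R_k(b;z)=\frac{(q^{\bar b};q)_k}{(q^{\lambda}\cos\eta_q;q)_k}\;{}_2\phi_1\big(q^{-k},q^b;q^{-\bar b-k+1};q,q^{-\bar b+1}z\big),$$ and for $k\ge1$ let $$d^{(b)}_{k+1}=\frac{(1-q^k)(1-q^{2\lambda+k-1})}{4(1-q^{\lambda+k-1}\cos\eta_q)(1-q^{\lambda+k}\cos\eta_q)}.$$ Let $\ell_1^{(b)}=0$ and $\ell_{k+1}^{(b)}=d_{k+1}^{(b)}/(1-\ell_k^{(b)})$ for $k\ge1$. This is well defined, and $0<\ell^{(b)}_{k+1}<1$ for $k\ge 1$, so that $(\ell^{(b)}_{k+1})_{k\ge0}$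 is the minimal parameter sequence of the positive chain sequence $(d^{(b)}_{k+1})_{k\ge1}$. For any constant $\hat\rho>0$ consider on the unit circle $\mathbb T$ the positive measure $$d\hat\mu^{(b)}(\zeta)=\hat\rho\,\frac{|(\zeta;q)_\infty|^2}{|(q^b\zeta;q)_\infty|^2}\,\frac{d\zeta}{2\pi i\zeta}.$$ Then $\hat\mu^{(b)}$ has exactly one sequence $(\hat\Phi_k)_{k\ge0}$ of monic orthogonal polynomials ($\hat\Phi_k$ monic of degree $k$, $\int_{\mathbb T}\overline{\hat\Phi_j}\,\hat\Phi_k\,d\hat\mu^{(b)}=0$ for $j\ne k$ and $\ne0$ for $j=k$), and $$\hat\Phi_k(b;z)=\frac{(q^\lambda\cos\eta_q;q)_{k+1}}{(q^b;q)_{k+1}}\cdot\frac{R_{k+1}(b;z)-2(1-\ell^{(b)}_{k+1})R_k(b;z)}{z-1},\qquad k\ge0,\ z\neq 1.$$ The Verblunsky coefficients $\hat\alpha^{(b)}_{k-1}=-\overline{\hat\Phi_k(b;0)}$ are $$\hat\alpha^{(b)}_{k-1}=-\Big[1-2\ell^{(b)}_{k+1}\frac{1-q^{\lambda+k}\cos\eta_q}{1-q^{\bar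 b+k}}\Big]\frac{(q^b;q)_k}{(q^{\bar b};q)_k},\qquad k\ge1.$$ Moreover, if $\hat\rho$ is such that $\hat\mu^{(b)}$ is a probability measure, then $\hat\mu^{(b)}$ has exactly one sequence of orthonormal polynomials with positive leading coefficients; it is $\hat\varphi_k=\hat\kappa_k^{(b)}\hat\Phi_k$ with $\hat\kappa_k^{(b)}>0$ and $$\big[\hat\kappa^{(b)}_k\big]^{-2}=\frac{(q;q)_k\,(q^{2\lambda};q)_k}{(q^{b+1};q)_k\,(q^{\bar b+1};q)_k}\cdot\frac{1-q^{\lambda+k}\cos\eta_q}{1-q^{\lambda}\cos\eta_q}\,(1-\ell^{(b)}_{k+1}),\qquad k\ge0.$$ -/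

import Mathlib

open MeasureTheory Polynomial
open scoped ComplexConjugate

noncomputable section

/-- The finite `q`-Pochhammer symbol `(a; q)_n = ∏_{i<n} (1 - a q^i)`. -/
def qPoch (q : ℝ) (a : ℂ) (n : ℕ) : ℂ :=
  ∏ i ∈ Finset.range n, (1 - a * (q : ℂ) ^ i)

/-- The infinite `q`-Pochhammer symbol `(a; q)_∞ = ∏_{i≥0} (1 - a q^i)`. -/
def qPochInf (q : ℝ) (a : ℂ) : ℂ :=
  ∏' i : ℕ, (1 - a * (q : ℂ) ^ i)

/-- The basic hypergeometric series
`₂φ₁(a, b; c; q, z) = ∑_{n≥0} (a;q)_n (b;q)_n / ((c;q)_n (q;q)_n) z^n`. When `a = q^{-k}` all the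
terms with `n > k` vanish (with the convention `0 / 0 = 0`) and the series is a polynomial in `z`. -/
def qPhi21 (q : ℝ) (a b c z : ℂ) : ℂ :=
  ∑' n : ℕ, qPoch q a n * qPoch q b n / (qPoch q c n * qPoch q (q : ℂ) n) * z ^ n

/-- The parameter `b = λ - iη`. -/
def bParam (lam eta : ℝ) : ℂ := (lam : ℂ) - Complex.I * (eta : ℂ)

/-- The number `q^λ cos(η_q)`, where `η_q = η ln q`. -/
def qCos (q lam eta : ℝ) : ℝ := q ^ lam * Real.cos (eta * Real.log q)

/-- The modified basic hypergeometric polynomials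
`R_k(b; z) = (q^{b̄};q)_k / (q^λ cos η_q;q)_k · ₂φ₁(q^{-k}, q^b; q^{-b̄-k+1}; q, q^{-b̄+1} z)`. -/
def modR (q lam eta : ℝ) (k : ℕ) (z : ℂ) : ℂ :=
  qPoch q ((q : ℂ) ^ conj (bParam lam eta)) k / qPoch q (qCos q lam eta : ℂ) k *
    qPhi21 q ((q : ℂ) ^ (-(k : ℂ))) ((q : ℂ) ^ bParam lam eta)
      ((q : ℂ) ^ (-conj (bParam lam eta) - (k : ℂ) + 1))
      ((q : ℂ) ^ (-conj (bParam lam eta) + 1) * z)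

/-- `chainD q λ η k` is
`d_{k+1} = (1-q^k)(1-q^{2λ+k-1}) / (4 (1-q^{λ+k-1} cos η_q)(1-q^{λ+k} cos η_q))`, for `k ≥ 1`. -/
def chainD (q lam eta : ℝ) (k : ℕ) : ℝ :=
  (1 - q ^ k) * (1 - q ^ (2 * lam + (k : ℝ) - 1)) /
    (4 * (1 - q ^ (lam + (k : ℝ) - 1) * Real.cos (eta * Real.log q)) *
      (1 - q ^ (lam + (k : ℝ)) * Real.cos (eta * Real.log q)))

/-- `minParam q λ η k` is `ℓ_{k+1}`, so that the recursion below reads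
`ℓ_1 = 0` and `ℓ_{k+1} = d_{k+1} / (1 - ℓ_k)` for `k ≥ 1`. -/
def minParam (q lam eta : ℝ) : ℕ → ℝ
  | 0 => 0
  | k + 1 => chainD q lam eta (k + 1) / (1 - minParam q lam eta k)

/-- The weight `|(ζ;q)_∞|² / |(q^b ζ;q)_∞|²`. -/
def hatWeight (q lam eta : ℝ) (ζ : ℂ) : ℝ :=
  ‖qPochInf q ζ‖ ^ 2 / ‖qPochInf q ((q : ℂ) ^ bParam lam eta * ζ)‖ ^ 2

/-- The measure `dμ(ζ) = ρ |(ζ;q)_∞|² / |(q^b ζ;q)_∞|² dζ / (2πiζ)` on the unit circle, as a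
measure on `ℂ`: since `dζ / (2πiζ) = dθ / (2π)` for `ζ = e^{iθ}`, it is the image under
`θ ↦ e^{iθ}` of the measure on `[0, 2π]` with density `ρ / (2π)` times the weight at `e^{iθ}`. -/
def hatMeasure (q lam eta rho : ℝ) : Measure ℂ :=
  Measure.map (fun θ : ℝ => Complex.exp ((θ : ℂ) * Complex.I))
    ((volume.restrict (Set.Icc 0 (2 * Real.pi))).withDensity
      (fun θ : ℝ => ENNReal.ofReal
        (rho / (2 * Real.pi) * hatWeight q lam eta (Complex.exp ((θ : ℂ) * Complex.I)))))

/-- The inner product `∫ conj(f) g dμ` of two polynomials with respect to a measure `μ` (which is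
supported on the unit circle in all uses below). -/
def circleInner (μ : Measure ℂ) (f g : ℂ[X]) : ℂ :=
  ∫ ζ : ℂ, conj (f.eval ζ) * g.eval ζ ∂μ

/-- `Φ` is the sequence of monic orthogonal polynomials on the unit circle with respect to `μ`:
`Φ_k` is monic of degree `k`, and `∫ conj(Φ_j) Φ_k dμ` is zero for `j ≠ k` and nonzero for
`j = k`. -/
def IsMonicOPUC (μ : Measure ℂ) (Φ : ℕ → ℂ[X]) : Prop :=
  (∀ k, (Φ k).Monic ∧ (Φ k).natDegree = k) ∧
    (∀ j k, j ≠ k → circleInner μ (Φ j) (Φ k) = 0) ∧ ∀ k, circleInner μ (Φ k) (Φ k) ≠ 0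

/-- `φ` is the sequence of orthonormal polynomials on the unit circle with respect to `μ`:
`φ_k = κ_k z^k + ⋯` has degree `k` with `κ_k > 0`, and `∫ conj(φ_j) φ_k dμ = δ_{j,k}`. -/
def IsOrthonormalOPUC (μ : Measure ℂ) (φ : ℕ → ℂ[X]) : Prop :=
  (∀ k, (φ k).natDegree = k ∧ ∃ κ : ℝ, 0 < κ ∧ (φ k).leadingCoeff = (κ : ℂ)) ∧
    ∀ j k, circleInner μ (φ j) (φ k) = if j = k then 1 else 0

/-- The Verblunsky coefficients `α_k = - conj(Φ_{k+1}(0))` of a sequence of monic polynomials. -/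
def verblunsky (Φ : ℕ → ℂ[X]) (k : ℕ) : ℂ := -conj ((Φ (k + 1)).eval 0)

end

/-! Put `B = q^b`, so that `|B| = q^λ < 1` and `B + B̄ = 2 q^λ cos η_q`. On the unit circle the
weight is `(1 - 1/ζ) F(ζ)` with `F(z) = (z, q/z; q)_∞ / (Bz, B̄/z; q)_∞` (`hatWeight_eq_thetaQuot`).
The quotient `F` is easier to handle than the weight: comparing `F` on the circles of radius `1` and
`q` gives a first-order recurrence for its moments (`selfMoment_zero_succ`).

Up to the factor `(q^λ cos η_q; q)_k`, the polynomial `R_k` is `S_k = selfRecip q B k`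
(`modR_eq_eval`). It obeys a three-term recurrence and is self-reciprocal on the circle. These two
facts and the moment recurrence show that `∫ ζ^{-m} S_k F dθ = 0` for `1 ≤ m ≤ k`
(`selfMoment_eq_zero`), and they give the integral at `m = 0` as a product times `∫ F dθ`
(`selfMoment_zero_right`).

The factor `1 - 1/ζ = (ζ - 1)/ζ` is absorbed by dividing by `z - 1`. If `S_{k+1} - c_k S_k` vanishes
at `1`, its quotient by `z - 1`, integrated against `ζ^{-j}` and the weight, is the integral of
`ζ^{-j-1} (S_{k+1} - c_k S_k) F`, which is zero for `j < k`. The required `c_k` is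
`S_{k+1}(1)/S_k(1)`. The three-term recurrence at `z = 1` turns into a recursion for this ratio, and
that recursion is the one defining the minimal parameters (`eval_one_selfRecip_succ`). At `j = k`
only the `S_k` term survives; reflection sends it to the exponent `0`, where the product formula
gives the norm. The value at `z = 0` gives the Verblunsky coefficients. -/

/-! ### Infinite `q`-Pochhammer symbols -/

theorem hasProdLocallyUniformlyOn_qPochInf {q : ℝ} (hq0 : 0 < q) (hq1 : q < 1) :
    HasProdLocallyUniformlyOn (fun (i : ℕ) (a : ℂ) => 1 - a * (q : ℂ) ^ i)
      (fun a => qPochInf q a) Set.univ := by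
  unfold qPochInf
  simp_rw [sub_eq_add_neg]
  refine hasProdLocallyUniformlyOn_of_forall_compact isOpen_univ fun K _ hK => ?_
  obtain ⟨R, hR⟩ := hK.isBounded.exists_norm_le
  refine ((summable_geometric_of_lt_one hq0.le hq1).mul_left R).hasProdUniformlyOn_nat_one_add
    hK (.of_forall fun n x hx => ?_) fun _ => by fun_prop
  simpa [abs_of_pos hq0] using mul_le_mul_of_nonneg_right (hR x hx) (pow_nonneg hq0.le n)

theorem differentiable_qPochInf {q : ℝ} (hq0 : 0 < q) (hq1 : q < 1) :
    Differentiable ℂ (qPochInf q) := by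
  rw [← differentiableOn_univ]
  exact (hasProdLocallyUniformlyOn_qPochInf hq0 hq1).differentiableOn
    (.of_forall fun _ => by
      simpa [Finset.prod_fn] using DifferentiableOn.finsetProd (fun _ _ => by fun_prop))
    isOpen_univ

theorem multipliable_qPochInf {q : ℝ} (hq0 : 0 < q) (hq1 : q < 1) (a : ℂ) :
    Multipliable fun i : ℕ => 1 - a * (q : ℂ) ^ i :=
  ((hasProdLocallyUniformlyOn_qPochInf hq0 hq1).hasProd (Set.mem_univ a)).multipliable

theorem qPochInf_eq_mul {q : ℝ} (hq0 : 0 < q) (hq1 : q < 1) (a : ℂ) :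
    qPochInf q a = (1 - a) * qPochInf q (q * a) := by
  unfold qPochInf
  have h : ∀ i : ℕ, 1 - a * (q : ℂ) ^ (i + 1) = 1 - q * a * (q : ℂ) ^ i := fun i => by ring
  rw [tprod_eq_zero_mul' (by simpa only [h] using multipliable_qPochInf hq0 hq1 (q * a))]
  simp only [h, pow_zero, mul_one]

theorem conj_qPochInf {q : ℝ} (hq0 : 0 < q) (hq1 : q < 1) (a : ℂ) :
    conj (qPochInf q a) = qPochInf q (conj a) := by
  unfold qPochInf
  have := (multipliable_qPochInf hq0 hq1 a).map_tprod (starRingEnd ℂ) Complex.continuous_conj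
  rw [this]
  simp

theorem qPochInf_ne_zero {q : ℝ} (hq0 : 0 < q) (hq1 : q < 1) {a : ℂ}
    (ha : ∀ i : ℕ, 1 - a * (q : ℂ) ^ i ≠ 0) : qPochInf q a ≠ 0 := by
  unfold qPochInf
  simp_rw [sub_eq_add_neg]
  refine tprod_one_add_ne_zero_of_summable (f := fun i : ℕ => -(a * (q : ℂ) ^ i))
    (fun i => by simpa [← sub_eq_add_neg] using ha i) ?_
  simpa [abs_of_pos hq0] using (summable_geometric_of_lt_one hq0.le hq1).mul_left ‖a‖

theorem one_sub_ne_zero_of_norm_lt_one {a : ℂ} (ha : ‖a‖ < 1) : 1 - a ≠ 0 := by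
  rintro h
  rw [sub_eq_zero] at h
  simp [← h] at ha

theorem norm_mul_pow_lt_one {q : ℝ} (hq0 : 0 < q) (hq1 : q < 1) {a : ℂ} (ha : ‖a‖ < 1) (i : ℕ) :
    ‖a * (q : ℂ) ^ i‖ < 1 := by
  rw [norm_mul, norm_pow, Complex.norm_real, Real.norm_of_nonneg hq0.le]
  exact (mul_le_of_le_one_right (norm_nonneg _) (pow_le_one₀ hq0.le hq1.le)).trans_lt ha

theorem qPochInf_ne_zero_of_norm_lt_one {q : ℝ} (hq0 : 0 < q) (hq1 : q < 1) {a : ℂ}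
    (ha : ‖a‖ < 1) : qPochInf q a ≠ 0 :=
  qPochInf_ne_zero hq0 hq1 fun i =>
    one_sub_ne_zero_of_norm_lt_one (norm_mul_pow_lt_one hq0 hq1 ha i)

/-! ### The theta quotient and its `q`-shift -/

/-- The function `(z, q/z; q)_∞ / (Bz, B̄/z; q)_∞`, the bilateral generating function of the
moments. -/
noncomputable def thetaQuot (q : ℝ) (B z : ℂ) : ℂ :=
  qPochInf q z * qPochInf q (q * z⁻¹) / (qPochInf q (B * z) * qPochInf q (conj B * z⁻¹))

theorem norm_mul_lt_one {B z : ℂ} (hB : ‖B‖ < 1) (hz : ‖z‖ ≤ 1) : ‖B * z‖ < 1 := by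
  rw [norm_mul]
  exact (mul_le_of_le_one_right (norm_nonneg _) hz).trans_lt hB

theorem continuousAt_thetaQuot {q : ℝ} (hq0 : 0 < q) (hq1 : q < 1) {B : ℂ} (hB : ‖B‖ < 1)
    {z : ℂ} (hz : ‖z‖ = 1) : ContinuousAt (thetaQuot q B) z := by
  have hd := (differentiable_qPochInf hq0 hq1).continuous
  have hz0 : z ≠ 0 := by
    rintro rfl
    simp at hz
  have h1 : qPochInf q (B * z) ≠ 0 :=
    qPochInf_ne_zero_of_norm_lt_one hq0 hq1 (norm_mul_lt_one hB hz.le)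
  have h2 : qPochInf q (conj B * z⁻¹) ≠ 0 :=
    qPochInf_ne_zero_of_norm_lt_one hq0 hq1
      (norm_mul_lt_one (by simpa using hB) (by simp [hz]))
  have hi : ContinuousAt (fun z : ℂ => z⁻¹) z := continuousAt_inv₀ hz0
  have c1 : ContinuousAt (fun z : ℂ => qPochInf q (q * z⁻¹)) z :=
    ContinuousAt.comp' hd.continuousAt (continuousAt_const.mul hi)
  have c2 : ContinuousAt (fun z : ℂ => qPochInf q (conj B * z⁻¹)) z :=
    ContinuousAt.comp' hd.continuousAt (continuousAt_const.mul hi)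
  have c3 : ContinuousAt (fun z : ℂ => qPochInf q (B * z)) z := by fun_prop
  exact (hd.continuousAt.mul c1).div (c3.mul c2) (mul_ne_zero h1 h2)

/-- Conjugation is `z ↦ 1/z` on the circle. It swaps the two denominator factors and turns the
numerator into `(1/z, qz; q)_∞`, so the whole change is `(1 - 1/z)/(1 - z) = -1/z`. -/
theorem conj_thetaQuot {q : ℝ} (hq0 : 0 < q) (hq1 : q < 1) (B : ℂ) {z : ℂ} (hz : ‖z‖ = 1) :
    conj (thetaQuot q B z) = -(z⁻¹ * thetaQuot q B z) := by
  have hz0 : z ≠ 0 := by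
    rintro rfl
    simp at hz
  have hc : conj z = z⁻¹ := (Complex.inv_eq_conj hz).symm
  simp only [thetaQuot, map_div₀, map_mul, conj_qPochInf hq0 hq1, map_inv₀, hc, inv_inv,
    Complex.conj_conj, Complex.conj_ofReal]
  rw [qPochInf_eq_mul hq0 hq1 z⁻¹, qPochInf_eq_mul hq0 hq1 z,
    mul_comm (qPochInf q (conj B * z⁻¹))]
  field_simp
  ring

theorem hatWeight_eq_thetaQuot {q lam eta : ℝ} (hq0 : 0 < q) (hq1 : q < 1) {z : ℂ}
    (hz : ‖z‖ = 1) :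
    (hatWeight q lam eta z : ℂ) = (1 - z⁻¹) * thetaQuot q ((q : ℂ) ^ bParam lam eta) z := by
  have hc : conj z = z⁻¹ := (Complex.inv_eq_conj hz).symm
  unfold hatWeight thetaQuot
  push_cast
  rw [← Complex.mul_conj', ← Complex.mul_conj', conj_qPochInf hq0 hq1, conj_qPochInf hq0 hq1,
    map_mul, hc, qPochInf_eq_mul hq0 hq1 z⁻¹]
  ring

/-- Cauchy's theorem on the annulus `q ≤ |z| ≤ 1`. The factor `1 - B̄/z` removes the only pole of
the quotient that can lie there, `z = B̄`; rescaling the inner circle by `q` then brings back the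
same quotient, up to elementary factors. -/
theorem circleIntegral_zpow_mul_thetaQuot_succ {q : ℝ} (hq0 : 0 < q) (hq1 : q < 1) {B : ℂ}
    (hB : ‖B‖ < 1) (n : ℤ) :
    (∮ z in C(0, 1), z ^ n * (thetaQuot q B z * (1 - conj B * z⁻¹))) =
      (q : ℂ) ^ (n + 1) * ∮ z in C(0, 1), z ^ n * (-(z⁻¹ * (thetaQuot q B z * (1 - B * z)))) := by
  have hd := differentiable_qPochInf hq0 hq1
  have hqc : (q : ℂ) ≠ 0 := by exact_mod_cast hq0.ne'
  set H : ℂ → ℂ := fun z => qPochInf q z * qPochInf q (q * z⁻¹) /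
    (qPochInf q (B * z) * qPochInf q (q * (conj B * z⁻¹))) with hH
  have hdiff : ∀ z : ℂ, q ≤ ‖z‖ → ‖z‖ ≤ 1 → DifferentiableAt ℂ (fun z => z ^ n * H z) z := by
    intro z hz1 hz2
    have hz0 : z ≠ 0 := by
      rintro rfl
      simp at hz1
      linarith
    have hn : ‖(q : ℂ) * (conj B * z⁻¹)‖ < 1 := by
      rw [show (q : ℂ) * (conj B * z⁻¹) = conj B * (q * z⁻¹) by ring]
      refine norm_mul_lt_one (by simpa using hB) ?_
      rw [norm_mul, norm_inv, Complex.norm_real, Real.norm_of_nonneg hq0.le, ← div_eq_mul_inv]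
      exact div_le_one_of_le₀ hz1 (norm_nonneg _)
    have h1 := qPochInf_ne_zero_of_norm_lt_one hq0 hq1 (norm_mul_lt_one hB hz2)
    have h2 := qPochInf_ne_zero_of_norm_lt_one hq0 hq1 hn
    have hi : DifferentiableAt ℂ (fun z : ℂ => z⁻¹) z := differentiableAt_inv hz0
    have c1 : DifferentiableAt ℂ (fun z : ℂ => qPochInf q (q * z⁻¹)) z :=
      DifferentiableAt.fun_comp' z hd.differentiableAt (hi.const_mul _)
    have c2 : DifferentiableAt ℂ (fun z : ℂ => qPochInf q (q * (conj B * z⁻¹))) z :=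
      DifferentiableAt.fun_comp' z hd.differentiableAt ((hi.const_mul _).const_mul _)
    have c3 : DifferentiableAt ℂ (fun z : ℂ => qPochInf q (B * z)) z :=
      DifferentiableAt.fun_comp' z hd.differentiableAt (differentiableAt_id.const_mul _)
    exact (differentiableAt_zpow.2 (Or.inl hz0)).mul
      ((hd.differentiableAt.mul c1).div (c3.mul c2) (mul_ne_zero h1 h2))
  have hshift : (∮ z in C(0, 1), z ^ n * H z) = ∮ z in C(0, q), z ^ n * H z := by
    refine Complex.circleIntegral_eq_of_differentiable_on_annulus_off_countable hq0 hq1.le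
      Set.countable_empty (fun z hz => ?_) fun z hz => ?_
    · simp at hz
      exact (hdiff z hz.2 hz.1).continuousAt.continuousWithinAt
    · simp at hz
      exact hdiff z hz.2.le hz.1.le
  -- In `q^{n+1}`, `q^n` comes from the power of `z` and one more `q` from `dz`.
  have hscale : (∮ z in C(0, q), z ^ n * H z) =
      (q : ℂ) ^ (n + 1) * ∮ z in C(0, 1), z ^ n * H (q * z) := by
    simp only [circleIntegral, ← intervalIntegral.integral_const_mul]
    refine intervalIntegral.integral_congr fun θ _ => ?_
    have : circleMap 0 q θ = q * circleMap 0 1 θ := by simp [circleMap]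
    simp only [deriv_circleMap, this, smul_eq_mul, mul_zpow, zpow_add₀ hqc, zpow_one]
    ring
  have hone : (∮ z in C(0, 1), z ^ n * (thetaQuot q B z * (1 - conj B * z⁻¹))) =
      ∮ z in C(0, 1), z ^ n * H z := by
    refine circleIntegral.integral_congr zero_le_one fun z hz => ?_
    have hz : ‖z‖ = 1 := by simpa using hz
    have h3 : 1 - conj B * z⁻¹ ≠ 0 :=
      one_sub_ne_zero_of_norm_lt_one (norm_mul_lt_one (by simpa using hB) (by simp [hz]))
    simp only [hH, thetaQuot]
    rw [qPochInf_eq_mul hq0 hq1 (conj B * z⁻¹)]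
    congr 1
    rw [div_mul_eq_mul_div, mul_comm (1 - conj B * z⁻¹) (qPochInf _ _), ← mul_assoc,
      mul_div_mul_right _ _ h3]
  have htwo : (∮ z in C(0, 1), z ^ n * (-(z⁻¹ * (thetaQuot q B z * (1 - B * z))))) =
      ∮ z in C(0, 1), z ^ n * H (q * z) := by
    refine circleIntegral.integral_congr zero_le_one fun z hz => ?_
    have hz : ‖z‖ = 1 := by simpa using hz
    have hz0 : z ≠ 0 := by
      rintro rfl
      simp at hz
    have h3 : 1 - B * z ≠ 0 := one_sub_ne_zero_of_norm_lt_one (norm_mul_lt_one hB hz.le)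
    have h4 : (q : ℂ) * (q * z)⁻¹ = z⁻¹ := by field_simp
    simp only [hH, thetaQuot]
    rw [show (q : ℂ) * (conj B * (q * z)⁻¹) = conj B * (q * (q * z)⁻¹) by ring, h4,
      show B * (q * z) = q * (B * z) by ring, qPochInf_eq_mul hq0 hq1 (B * z),
      qPochInf_eq_mul hq0 hq1 z⁻¹, qPochInf_eq_mul hq0 hq1 z, div_mul_eq_mul_div,
      mul_comm (1 - B * z) (qPochInf _ _), mul_right_comm (qPochInf q (q * (B * z))),
      mul_div_mul_right _ _ h3]
    field_simp
    ring
  rw [hone, hshift, hscale, htwo]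

/-! ### Finite `q`-Pochhammer symbols and the polynomials `S_k` -/

theorem qPoch_zero (q : ℝ) (a : ℂ) : qPoch q a 0 = 1 := by simp [qPoch]

theorem qPoch_succ (q : ℝ) (a : ℂ) (n : ℕ) :
    qPoch q a (n + 1) = qPoch q a n * (1 - a * (q : ℂ) ^ n) := by
  simp [qPoch, Finset.prod_range_succ]

theorem qPoch_succ' (q : ℝ) (a : ℂ) (n : ℕ) :
    qPoch q a (n + 1) = (1 - a) * qPoch q (a * q) n := by
  simp [qPoch, Finset.prod_range_succ', pow_succ', mul_comm, mul_assoc]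

theorem conj_qPoch (q : ℝ) (a : ℂ) (n : ℕ) : conj (qPoch q a n) = qPoch q (conj a) n := by
  simp [qPoch, map_prod]

theorem qPoch_ne_zero {q : ℝ} (hq0 : 0 < q) (hq1 : q < 1) {a : ℂ} (ha : ‖a‖ < 1) (n : ℕ) :
    qPoch q a n ≠ 0 :=
  Finset.prod_ne_zero_iff.2 fun i _ =>
    one_sub_ne_zero_of_norm_lt_one (norm_mul_pow_lt_one hq0 hq1 ha i)

theorem norm_ofReal_lt_one {q : ℝ} (hq0 : 0 < q) (hq1 : q < 1) : ‖(q : ℂ)‖ < 1 := by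
  rwa [Complex.norm_real, Real.norm_of_nonneg hq0.le]

/-- The polynomials `∑_j [k, j]_q (B; q)_j (B̄; q)_{k-j} z^j`, through their three-term
recurrence. -/
noncomputable def selfRecip (q : ℝ) (B : ℂ) : ℕ → ℂ[X]
  | 0 => 1
  | 1 => C (1 - conj B) + C (1 - B) * X
  | k + 2 => (C (1 - conj B * (q : ℂ) ^ (k + 1)) + C (1 - B * (q : ℂ) ^ (k + 1)) * X) *
        selfRecip q B (k + 1) -
      C ((1 - (q : ℂ) ^ (k + 1)) * (1 - B * conj B * (q : ℂ) ^ k)) * X * selfRecip q B k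

theorem natDegree_selfRecip_le (q : ℝ) (B : ℂ) (k : ℕ) : (selfRecip q B k).natDegree ≤ k := by
  induction k using Nat.twoStepInduction with
  | zero => simp [selfRecip]
  | one =>
    rw [selfRecip]
    compute_degree
  | more k h1 h2 =>
    rw [selfRecip]
    refine (natDegree_sub_le _ _).trans (max_le ?_ ?_)
    · refine natDegree_mul_le.trans ?_
      have : (C (1 - conj B * (q : ℂ) ^ (k + 1)) +
          C (1 - B * (q : ℂ) ^ (k + 1)) * X).natDegree ≤ 1 := by compute_degree
      omega
    · refine natDegree_mul_le.trans ?_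
      have : (C ((1 - (q : ℂ) ^ (k + 1)) * (1 - B * conj B * (q : ℂ) ^ k)) * X).natDegree ≤ 1 := by
        compute_degree
      omega

theorem coeff_selfRecip {q : ℝ} (hq0 : 0 < q) (hq1 : q < 1) (B : ℂ) (k i l : ℕ) (h : i + l = k) :
    (selfRecip q B k).coeff i =
      qPoch q q k * (qPoch q B i / qPoch q q i) * (qPoch q (conj B) l / qPoch q q l) := by
  have hne := qPoch_ne_zero hq0 hq1 (norm_ofReal_lt_one hq0 hq1)
  have hne' : ∀ n : ℕ, 1 - (q : ℂ) * (q : ℂ) ^ n ≠ 0 := fun n =>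
    one_sub_ne_zero_of_norm_lt_one
      (norm_mul_pow_lt_one hq0 hq1 (norm_ofReal_lt_one hq0 hq1) n)
  induction k using Nat.twoStepInduction generalizing i l with
  | zero =>
    obtain ⟨rfl, rfl⟩ : i = 0 ∧ l = 0 := by omega
    simp [selfRecip, qPoch_zero]
  | one =>
    have h0 := hne' 0
    simp only [pow_zero, mul_one] at h0
    obtain ⟨rfl, rfl⟩ | ⟨rfl, rfl⟩ : i = 0 ∧ l = 1 ∨ i = 1 ∧ l = 0 := by omega
    · simp [selfRecip, qPoch]
      field_simp
    · simp [selfRecip, qPoch, coeff_one]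
      field_simp
  | more k h1 h2 =>
    have e1 : ∀ n, (selfRecip q B n).coeff (n + 1) = 0 := fun n =>
      coeff_eq_zero_of_natDegree_lt (Nat.lt_succ_of_le (natDegree_selfRecip_le q B n))
    rw [selfRecip]
    -- Only one term of the recurrence contributes to each of the two end coefficients; all three
    -- contribute to an interior one.
    rcases i with _ | i
    · obtain rfl : l = k + 1 + 1 := by omega
      simp only [coeff_sub, add_mul, coeff_add, coeff_C_mul, mul_assoc, coeff_X_mul_zero,
        h2 0 (k + 1) (by omega)]
      have := hne k
      rw [qPoch_succ q _ (k + 1), qPoch_succ q (conj B) (k + 1)]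
      have := hne (k + 1)
      have hw := hne' (k + 1)
      simp only [qPoch_zero]
      generalize 1 - (q : ℂ) * (q : ℂ) ^ (k + 1) = w at hw ⊢
      field_simp
      ring
    rcases l with _ | l
    · obtain rfl : i = k + 1 := by omega
      simp only [coeff_sub, add_mul, coeff_add, coeff_C_mul, mul_assoc, coeff_X_mul,
        h2 (k + 1) 0 (by omega), e1]
      rw [qPoch_succ q _ (k + 1), qPoch_succ q B (k + 1)]
      have := hne (k + 1)
      have hw := hne' (k + 1)
      simp only [qPoch_zero]
      generalize 1 - (q : ℂ) * (q : ℂ) ^ (k + 1) = w at hw ⊢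
      field_simp
      ring
    · obtain rfl : k = i + l := by omega
      simp only [coeff_sub, add_mul, coeff_add, coeff_C_mul, mul_assoc, coeff_X_mul,
        h2 (i + 1) l (by omega), h2 i (l + 1) (by omega), h1 i l rfl]
      rw [qPoch_succ q _ (i + l + 1), qPoch_succ q _ (i + l), qPoch_succ q B i,
        qPoch_succ q (conj B) l, qPoch_succ q _ i, qPoch_succ q _ l]
      have := hne i
      have := hne l
      have := hne' i
      have := hne' l
      field_simp
      ring

theorem coeff_selfRecip_self {q : ℝ} (hq0 : 0 < q) (hq1 : q < 1) (B : ℂ) (k : ℕ) :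
    (selfRecip q B k).coeff k = qPoch q B k := by
  rw [coeff_selfRecip hq0 hq1 B k k 0 rfl, qPoch_zero, qPoch_zero]
  have := qPoch_ne_zero hq0 hq1 (norm_ofReal_lt_one hq0 hq1) k
  field_simp

theorem eval_zero_selfRecip {q : ℝ} (hq0 : 0 < q) (hq1 : q < 1) (B : ℂ) (k : ℕ) :
    (selfRecip q B k).eval 0 = qPoch q (conj B) k := by
  rw [← coeff_zero_eq_eval_zero, coeff_selfRecip hq0 hq1 B k 0 k (zero_add k), qPoch_zero,
    qPoch_zero]
  have := qPoch_ne_zero hq0 hq1 (norm_ofReal_lt_one hq0 hq1) k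
  field_simp

/-- Reversing the last `n` factors of `(A; q)_{n+l}` and of `(q; q)_{n+l}` produces the same signs
and, up to `(A/q)^n`, the same powers of `q`. Comparing the two leaves `(q/A)^n`, which is the
argument scaling in the `₂φ₁` of `R_k`. -/
theorem qPoch_reverse {q : ℝ} (hq0 : 0 < q) {A : ℂ} (hA : A ≠ 0) (n l : ℕ) :
    qPoch q ((q : ℂ) ^ (n + l))⁻¹ n * (A⁻¹ * q) ^ n * qPoch q A (n + l) * qPoch q q l =
      qPoch q (A⁻¹ * ((q : ℂ) ^ (n + l))⁻¹ * q) n * qPoch q A l * qPoch q q (n + l) := by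
  have hqc : (q : ℂ) ≠ 0 := by exact_mod_cast hq0.ne'
  suffices H : ∀ N, ∀ n l, n + l = N →
      qPoch q ((q : ℂ) ^ N)⁻¹ n * (A⁻¹ * q) ^ n * qPoch q A N * qPoch q q l =
        qPoch q (A⁻¹ * ((q : ℂ) ^ N)⁻¹ * q) n * qPoch q A l * qPoch q q N from
    H _ n l rfl
  intro N n
  induction n with
  | zero =>
    intro l h
    obtain rfl : l = N := by omega
    simp [qPoch_zero]
  | succ n ih =>
    intro l h
    have e := ih (l + 1) (by omega)
    rw [qPoch_succ q _ l, qPoch_succ q A l] at e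
    obtain rfl : N = n + l + 1 := by omega
    rw [qPoch_succ q _ n, qPoch_succ q _ n, pow_succ _ n]
    have e1 : (1 - ((q : ℂ) ^ (n + l + 1))⁻¹ * (q : ℂ) ^ n) * (A⁻¹ * q) =
        -(A⁻¹ * ((q : ℂ) ^ l)⁻¹) * (1 - q * (q : ℂ) ^ l) := by
      field_simp
      ring
    have e2 : 1 - A⁻¹ * ((q : ℂ) ^ (n + l + 1))⁻¹ * q * (q : ℂ) ^ n =
        -(A⁻¹ * ((q : ℂ) ^ l)⁻¹) * (1 - A * (q : ℂ) ^ l) := by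
      field_simp
      ring
    rw [e2]
    linear_combination (-(A⁻¹ * ((q : ℂ) ^ l)⁻¹)) * e +
      (qPoch q ((q : ℂ) ^ (n + l + 1))⁻¹ n * (A⁻¹ * q) ^ n * qPoch q A (n + l + 1) *
        qPoch q q l) * e1

theorem qPoch_eq_zero {q : ℝ} (hq0 : 0 < q) {k n : ℕ} (h : k < n) :
    qPoch q ((q : ℂ) ^ k)⁻¹ n = 0 := by
  have hqc : (q : ℂ) ≠ 0 := by exact_mod_cast hq0.ne'
  refine Finset.prod_eq_zero (Finset.mem_range.2 h) ?_
  field_simp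
  simp

/-! ### The parameter `B = q^b` and the identification of `R_k` with `S_k` -/

section Parameter

variable {q lam eta : ℝ}

theorem conj_cpow_bParam (hq0 : 0 < q) :
    (q : ℂ) ^ conj (bParam lam eta) = conj ((q : ℂ) ^ bParam lam eta) := by
  rw [Complex.cpow_conj _ _ (by rw [Complex.arg_ofReal_of_nonneg hq0.le]; exact Real.pi_pos.ne),
    Complex.conj_ofReal]

theorem norm_cpow_bParam (hq0 : 0 < q) : ‖(q : ℂ) ^ bParam lam eta‖ = q ^ lam := by
  rw [Complex.norm_cpow_eq_rpow_re_of_pos hq0]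
  simp [bParam]

theorem norm_cpow_bParam_lt_one (hq0 : 0 < q) (hq1 : q < 1) (hlam : 0 < lam) :
    ‖(q : ℂ) ^ bParam lam eta‖ < 1 := by
  rw [norm_cpow_bParam hq0]
  exact Real.rpow_lt_one hq0.le hq1 hlam

theorem cpow_bParam_add_conj (hq0 : 0 < q) :
    (q : ℂ) ^ bParam lam eta + conj ((q : ℂ) ^ bParam lam eta) = 2 * (qCos q lam eta : ℂ) := by
  have hqc : (q : ℂ) ≠ 0 := by exact_mod_cast hq0.ne'
  have : ((q : ℂ) ^ bParam lam eta).re = qCos q lam eta := by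
    rw [Complex.cpow_def_of_ne_zero hqc, Complex.exp_re, ← Complex.ofReal_log hq0.le, qCos,
      Real.rpow_def_of_pos hq0]
    simp [bParam, mul_comm eta]
  rw [Complex.add_conj, this]
  push_cast
  ring

theorem cpow_bParam_mul_conj (hq0 : 0 < q) :
    (q : ℂ) ^ bParam lam eta * conj ((q : ℂ) ^ bParam lam eta) = (q : ℂ) ^ (2 * (lam : ℂ)) := by
  have hqc : (q : ℂ) ≠ 0 := by exact_mod_cast hq0.ne'
  rw [← conj_cpow_bParam hq0, ← Complex.cpow_add _ _ hqc]
  congr 1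
  simp [bParam]
  ring

theorem cpow_two_mul_eq (hq0 : 0 < q) :
    (q : ℂ) ^ (2 * (lam : ℂ)) = ((q ^ (2 * lam) : ℝ) : ℂ) := by
  rw [Complex.ofReal_cpow hq0.le]
  push_cast
  rfl

theorem abs_qCos_lt_one (hq0 : 0 < q) (hq1 : q < 1) (hlam : 0 < lam) :
    |qCos q lam eta| < 1 := by
  rw [qCos, abs_mul, abs_of_pos (Real.rpow_pos_of_pos hq0 _)]
  exact (mul_le_of_le_one_right (Real.rpow_pos_of_pos hq0 _).le (Real.abs_cos_le_one _)).trans_lt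
    (Real.rpow_lt_one hq0.le hq1 hlam)

theorem norm_qCos_lt_one (hq0 : 0 < q) (hq1 : q < 1) (hlam : 0 < lam) :
    ‖(qCos q lam eta : ℂ)‖ < 1 := by
  rw [Complex.norm_real]
  exact abs_qCos_lt_one hq0 hq1 hlam

theorem pow_mul_qCos_lt_one (hq0 : 0 < q) (hq1 : q < 1) (hlam : 0 < lam) (k : ℕ) :
    q ^ k * qCos q lam eta < 1 := by
  refine (le_abs_self _).trans_lt ?_
  rw [abs_mul, abs_of_pos (pow_pos hq0 k)]
  exact (mul_le_of_le_one_left (abs_nonneg _) (pow_le_one₀ hq0.le hq1.le)).trans_lt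
    (abs_qCos_lt_one hq0 hq1 hlam)

theorem modR_eq_eval (hq0 : 0 < q) (hq1 : q < 1) (hlam : 0 < lam) (k : ℕ) (z : ℂ) :
    modR q lam eta k z =
      (selfRecip q ((q : ℂ) ^ bParam lam eta) k).eval z / qPoch q (qCos q lam eta) k := by
  have hqc : (q : ℂ) ≠ 0 := by exact_mod_cast hq0.ne'
  have hB1 := norm_cpow_bParam_lt_one (eta := eta) hq0 hq1 hlam
  have hB0 : (q : ℂ) ^ bParam lam eta ≠ 0 := by simp [Complex.cpow_eq_zero_iff, hqc]
  unfold modR qPhi21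
  rw [conj_cpow_bParam hq0, Complex.cpow_neg, Complex.cpow_natCast, Complex.cpow_add _ _ hqc,
    Complex.cpow_add _ _ hqc, Complex.cpow_sub _ _ hqc, Complex.cpow_neg, Complex.cpow_natCast,
    Complex.cpow_one, conj_cpow_bParam hq0]
  generalize (q : ℂ) ^ bParam lam eta = B at *
  have hA0 : conj B ≠ 0 := by simpa using hB0
  have hA1 : ‖conj B‖ < 1 := by simpa using hB1
  -- For `n > k` the denominator can vanish together with the numerator, for instance when `B̄ =
  -- q^m` with `m ≥ 1` an integer; the convention `0 / 0 = 0` then makes the term zero.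
  rw [tsum_eq_sum (s := Finset.range (k + 1)) fun n hn => by
      rw [qPoch_eq_zero hq0 (by simpa using hn)]
      simp,
    eval_eq_sum_range' (Nat.lt_succ_of_le (natDegree_selfRecip_le q B k)), div_mul_eq_mul_div,
    Finset.mul_sum]
  congr 1
  refine Finset.sum_congr rfl fun n hn => ?_
  obtain ⟨l, rfl⟩ := Nat.exists_eq_add_of_le (Finset.mem_range_succ_iff.1 hn)
  rw [coeff_selfRecip hq0 hq1 B _ n l rfl]
  have e := qPoch_reverse hq0 hA0 n l
  -- A factor with index `i < n` vanishes only if `B̄ q^{n+l-1-i} = 1`, which `|B̄| < 1` excludes.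
  have hc : qPoch q ((conj B)⁻¹ / (q : ℂ) ^ (n + l) * q) n ≠ 0 := by
    refine Finset.prod_ne_zero_iff.2 fun i hi h => ?_
    have hi := Finset.mem_range.1 hi
    obtain ⟨m, rfl⟩ := Nat.exists_eq_add_of_le (Nat.succ_le_of_lt hi)
    refine one_sub_ne_zero_of_norm_lt_one (norm_mul_pow_lt_one hq0 hq1 hA1 (m + l)) ?_
    rw [sub_eq_zero] at h ⊢
    field_simp at h
    have h2 : (q : ℂ) ^ i * q * (conj B * (q : ℂ) ^ (m + l)) = (q : ℂ) ^ i * q * 1 := by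
      rw [mul_one]
      simp only [Nat.succ_eq_add_one] at h
      linear_combination h
    exact (mul_left_cancel₀ (mul_ne_zero (pow_ne_zero _ hqc) hqc) h2).symm
  rw [div_eq_mul_inv (conj B)⁻¹] at hc ⊢
  have h1 := qPoch_ne_zero hq0 hq1 (norm_ofReal_lt_one hq0 hq1) n
  have h2 := qPoch_ne_zero hq0 hq1 (norm_ofReal_lt_one hq0 hq1) l
  rw [mul_pow]
  generalize qPoch q ((conj B)⁻¹ * ((q : ℂ) ^ (n + l))⁻¹ * q) n = D at e hc ⊢
  generalize ((conj B)⁻¹ * (q : ℂ)) ^ n = E at e ⊢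
  generalize qPoch q ((q : ℂ) ^ (n + l))⁻¹ n = G at e ⊢
  field_simp
  linear_combination (qPoch q B n * z ^ n) * e
end Parameter

/-! ### The chain sequence and its minimal parameters -/

section ChainSequence

variable {q lam eta : ℝ}

theorem chainD_succ (hq0 : 0 < q) (k : ℕ) :
    chainD q lam eta (k + 1) = (1 - q ^ (k + 1)) * (1 - q ^ (2 * lam) * q ^ k) /
      (4 * (1 - q ^ k * qCos q lam eta) * (1 - q ^ (k + 1) * qCos q lam eta)) := by
  unfold chainD qCos
  have e1 : q ^ (2 * lam + ((k + 1 : ℕ) : ℝ) - 1) = q ^ (2 * lam) * q ^ k := by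
    rw [← Real.rpow_natCast, ← Real.rpow_add hq0]
    push_cast
    ring_nf
  have e2 : q ^ (lam + ((k + 1 : ℕ) : ℝ) - 1) = q ^ lam * q ^ k := by
    rw [← Real.rpow_natCast, ← Real.rpow_add hq0]
    push_cast
    ring_nf
  have e3 : q ^ (lam + ((k + 1 : ℕ) : ℝ)) = q ^ lam * q ^ (k + 1) := by
    rw [← Real.rpow_natCast, ← Real.rpow_add hq0]
  rw [e1, e2, e3]
  ring

theorem two_mul_qCos_le (hq0 : 0 < q) : 2 * qCos q lam eta ≤ 1 + q ^ (2 * lam) := by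
  have h1 : qCos q lam eta ≤ q ^ lam :=
    mul_le_of_le_one_right (Real.rpow_pos_of_pos hq0 _).le (Real.cos_le_one _)
  have h2 : q ^ (2 * lam) = q ^ lam * q ^ lam := by
    rw [← Real.rpow_add hq0, two_mul]
  nlinarith [sq_nonneg (1 - q ^ lam)]

theorem chainD_succ_pos (hq0 : 0 < q) (hq1 : q < 1) (hlam : 0 < lam) (k : ℕ) :
    0 < chainD q lam eta (k + 1) := by
  rw [chainD_succ hq0]
  have h1 := pow_mul_qCos_lt_one (eta := eta) hq0 hq1 hlam k
  have h2 := pow_mul_qCos_lt_one (eta := eta) hq0 hq1 hlam (k + 1)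
  have h3 : q ^ (k + 1) < 1 := pow_lt_one₀ hq0.le hq1 (by simp)
  have h4 : q ^ (2 * lam) * q ^ k < 1 :=
    (mul_le_of_le_one_right (Real.rpow_pos_of_pos hq0 _).le (pow_le_one₀ hq0.le hq1.le)).trans_lt
      (Real.rpow_lt_one hq0.le hq1 (by linarith))
  have := sub_pos.2 h1
  have := sub_pos.2 h2
  have := sub_pos.2 h3
  have := sub_pos.2 h4
  positivity

/-- Comparison with the explicit sequence `M_k = (1 - q^k) / (2 (1 - q^k q^λ cos η_q)) < 1`. It
satisfies `d_{k+2} ≤ (1 - M_k) M_{k+1}`, because `2 q^λ cos η_q ≤ 1 + q^{2λ}`, so the recursion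
keeps the minimal parameters below it. The bound is what makes the induction for `< 1` close. -/
theorem minParam_le (hq0 : 0 < q) (hq1 : q < 1) (hlam : 0 < lam) (k : ℕ) :
    minParam q lam eta k ≤ (1 - q ^ k) / (2 * (1 - q ^ k * qCos q lam eta)) ∧
      minParam q lam eta k < 1 := by
  have hbound : ∀ k : ℕ, (1 - q ^ k) / (2 * (1 - q ^ k * qCos q lam eta)) < 1 := fun k => by
    have h1 := pow_mul_qCos_lt_one (eta := eta) hq0 hq1 hlam k
    have h2 : 0 < q ^ k := pow_pos hq0 k
    rw [div_lt_one (by linarith)]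
    have h3 : q ^ k ≤ 1 := pow_le_one₀ hq0.le hq1.le
    have h4 := (le_abs_self _).trans_lt (abs_qCos_lt_one (eta := eta) hq0 hq1 hlam)
    nlinarith
  suffices h : minParam q lam eta k ≤ (1 - q ^ k) / (2 * (1 - q ^ k * qCos q lam eta)) from
    ⟨h, h.trans_lt (hbound k)⟩
  induction k with
  | zero => simp [minParam]
  | succ k ih =>
    have h1 := sub_pos.2 (pow_mul_qCos_lt_one (eta := eta) hq0 hq1 hlam k)
    have h2 := sub_pos.2 (pow_mul_qCos_lt_one (eta := eta) hq0 hq1 hlam (k + 1))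
    have h3 : 0 ≤ 1 - q ^ (k + 1) := sub_nonneg.2 (pow_le_one₀ hq0.le hq1.le)
    rw [minParam, div_le_iff₀ (sub_pos.2 (ih.trans_lt (hbound k)))]
    have h5 : 1 - (1 - q ^ k) / (2 * (1 - q ^ k * qCos q lam eta)) =
        (1 + q ^ k - 2 * q ^ k * qCos q lam eta) / (2 * (1 - q ^ k * qCos q lam eta)) := by
      field_simp
      ring
    calc chainD q lam eta (k + 1)
        ≤ (1 - q ^ (k + 1)) / (2 * (1 - q ^ (k + 1) * qCos q lam eta)) *
          (1 - (1 - q ^ k) / (2 * (1 - q ^ k * qCos q lam eta))) := by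
          rw [chainD_succ hq0, h5, div_mul_div_comm,
            show 2 * (1 - q ^ (k + 1) * qCos q lam eta) * (2 * (1 - q ^ k * qCos q lam eta)) =
              4 * (1 - q ^ k * qCos q lam eta) * (1 - q ^ (k + 1) * qCos q lam eta) by ring]
          refine div_le_div_of_nonneg_right (mul_le_mul_of_nonneg_left ?_ h3) (by positivity)
          nlinarith [mul_le_mul_of_nonneg_left (two_mul_qCos_le (lam := lam) (eta := eta) hq0)
            (pow_pos hq0 k).le]
      _ ≤ _ := by gcongr

theorem minParam_lt_one (hq0 : 0 < q) (hq1 : q < 1) (hlam : 0 < lam) (k : ℕ) :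
    minParam q lam eta k < 1 :=
  (minParam_le hq0 hq1 hlam k).2

/-- After division by `(q^λ cos η_q; q)_{k+2}` the three-term recurrence at `z = 1` reads `R_{k+2} =
2 R_{k+1} - 4 d_{k+2} R_k`. With `R_{k+1} = 2 (1 - ℓ_{k+1}) R_k` this is `ℓ_{k+2} = d_{k+2} / (1 -
ℓ_{k+1})`. -/
theorem eval_one_selfRecip_succ (hq0 : 0 < q) (hq1 : q < 1) (hlam : 0 < lam) (k : ℕ) :
    (selfRecip q ((q : ℂ) ^ bParam lam eta) (k + 1)).eval 1 =
      2 * (1 - (minParam q lam eta k : ℂ)) * (1 - (q : ℂ) ^ k * (qCos q lam eta : ℂ)) *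
        (selfRecip q ((q : ℂ) ^ bParam lam eta) k).eval 1 := by
  have hadd := cpow_bParam_add_conj (lam := lam) (eta := eta) hq0
  have hmul := cpow_bParam_mul_conj (lam := lam) (eta := eta) hq0
  rw [cpow_two_mul_eq hq0] at hmul
  induction k with
  | zero =>
    simp [selfRecip, minParam]
    linear_combination -hadd
  | succ k ih =>
    have h0 : (1 - (minParam q lam eta k : ℂ)) ≠ 0 := by
      exact_mod_cast (sub_pos.2 (minParam_lt_one hq0 hq1 hlam k)).ne'
    have h1 : 1 - (q : ℂ) ^ k * (qCos q lam eta : ℂ) ≠ 0 := by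
      exact_mod_cast (sub_pos.2 (pow_mul_qCos_lt_one hq0 hq1 hlam k)).ne'
    have h2 : 1 - (q : ℂ) ^ (k + 1) * (qCos q lam eta : ℂ) ≠ 0 := by
      exact_mod_cast (sub_pos.2 (pow_mul_qCos_lt_one hq0 hq1 hlam (k + 1))).ne'
    rw [selfRecip, minParam, chainD_succ hq0]
    simp only [eval_sub, eval_mul, eval_add, eval_C, eval_X, mul_one, hmul]
    rw [ih]
    push_cast
    generalize (qCos q lam eta : ℂ) = c at *
    generalize (minParam q lam eta k : ℂ) = l at *
    generalize ((q ^ (2 * lam) : ℝ) : ℂ) = x at *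
    generalize (q : ℂ) ^ (k + 1) = u at *
    generalize (q : ℂ) ^ k = v at *
    field_simp
    generalize (selfRecip q ((q : ℂ) ^ bParam lam eta) k).eval 1 = E at *
    linear_combination (-8 * E * u * (1 - l) * (1 - v * c)) * hadd

end ChainSequence

/-! ### Moments of `S_k` against the theta quotient -/

section Moments

variable {q : ℝ} {B : ℂ}

/-- `selfMoment q B k p` is `∫ ζ^p S_k(ζ) F(ζ) dθ`, where `S_k` is `selfRecip q B k`, `F` is
`thetaQuot q B` and `ζ = exp (iθ)` runs over the unit circle. -/
noncomputable def selfMoment (q : ℝ) (B : ℂ) (k : ℕ) (p : ℤ) : ℂ :=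
  ∫ θ in (0 : ℝ)..2 * Real.pi, Complex.exp (θ * Complex.I) ^ p *
    ((selfRecip q B k).eval (Complex.exp (θ * Complex.I)) *
      thetaQuot q B (Complex.exp (θ * Complex.I)))

theorem continuous_thetaQuot_exp (hq0 : 0 < q) (hq1 : q < 1) (hB : ‖B‖ < 1) :
    Continuous fun θ : ℝ => thetaQuot q B (Complex.exp (θ * Complex.I)) :=
  continuous_iff_continuousAt.2 fun θ =>
    ContinuousAt.comp' (continuousAt_thetaQuot hq0 hq1 hB (Complex.norm_exp_ofReal_mul_I θ))
      (by fun_prop)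

theorem continuous_exp_zpow (p : ℤ) :
    Continuous fun θ : ℝ => Complex.exp (θ * Complex.I) ^ p :=
  Continuous.zpow₀ (by fun_prop) p fun θ => Or.inl (Complex.exp_ne_zero _)

theorem continuous_eval_exp (P : ℂ[X]) :
    Continuous fun θ : ℝ => P.eval (Complex.exp (θ * Complex.I)) :=
  P.continuous.comp' (by fun_prop)

theorem intervalIntegrable_selfMoment (hq0 : 0 < q) (hq1 : q < 1) (hB : ‖B‖ < 1) (p : ℤ)
    (P : ℂ[X]) (a b : ℝ) :
    IntervalIntegrable (fun θ : ℝ => Complex.exp (θ * Complex.I) ^ p *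
      (P.eval (Complex.exp (θ * Complex.I)) * thetaQuot q B (Complex.exp (θ * Complex.I))))
      volume a b :=
  ((continuous_exp_zpow p).mul ((continuous_eval_exp P).mul
    (continuous_thetaQuot_exp hq0 hq1 hB))).intervalIntegrable a b

theorem selfMoment_one (hq0 : 0 < q) (hq1 : q < 1) (hB : ‖B‖ < 1) (p : ℤ) :
    selfMoment q B 1 p =
      (1 - conj B) * selfMoment q B 0 p + (1 - B) * selfMoment q B 0 (p + 1) := by
  unfold selfMoment
  have hi := intervalIntegrable_selfMoment hq0 hq1 hB
  rw [← intervalIntegral.integral_const_mul, ← intervalIntegral.integral_const_mul,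
    ← intervalIntegral.integral_add ((hi _ _ _ _).const_mul _) ((hi _ _ _ _).const_mul _)]
  refine intervalIntegral.integral_congr fun θ _ => ?_
  simp only [selfRecip, zpow_add₀ (Complex.exp_ne_zero _), zpow_one, eval_add, eval_mul, eval_C,
    eval_X, eval_one]
  ring

theorem selfMoment_add_two (hq0 : 0 < q) (hq1 : q < 1) (hB : ‖B‖ < 1) (k : ℕ) (p : ℤ) :
    selfMoment q B (k + 2) p =
      (1 - conj B * (q : ℂ) ^ (k + 1)) * selfMoment q B (k + 1) p +
        (1 - B * (q : ℂ) ^ (k + 1)) * selfMoment q B (k + 1) (p + 1) -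
      (1 - (q : ℂ) ^ (k + 1)) * (1 - B * conj B * (q : ℂ) ^ k) * selfMoment q B k (p + 1) := by
  unfold selfMoment
  have hi := intervalIntegrable_selfMoment hq0 hq1 hB
  rw [← intervalIntegral.integral_const_mul, ← intervalIntegral.integral_const_mul,
    ← intervalIntegral.integral_const_mul,
    ← intervalIntegral.integral_add ((hi _ _ _ _).const_mul _) ((hi _ _ _ _).const_mul _),
    ← intervalIntegral.integral_sub
      (((hi _ _ _ _).const_mul _).add ((hi _ _ _ _).const_mul _)) ((hi _ _ _ _).const_mul _)]
  refine intervalIntegral.integral_congr fun θ _ => ?_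
  simp only [selfRecip, zpow_add₀ (Complex.exp_ne_zero _), zpow_one, eval_add, eval_sub,
    eval_mul, eval_C, eval_X]
  ring

theorem circleIntegral_zpow_eq_selfMoment (n : ℤ) :
    (∮ z in C(0, 1), z ^ n * thetaQuot q B z) = Complex.I * selfMoment q B 0 (n + 1) := by
  rw [circleIntegral, selfMoment, ← intervalIntegral.integral_const_mul]
  refine intervalIntegral.integral_congr fun θ _ => ?_
  simp only [deriv_circleMap, circleMap, selfRecip, zpow_add₀ (Complex.exp_ne_zero _), zpow_one,
    smul_eq_mul, eval_one]
  push_cast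
  rw [zero_add, one_mul]
  ring

theorem selfMoment_zero_succ (hq0 : 0 < q) (hq1 : q < 1) (hB : ‖B‖ < 1) (n : ℤ) :
    selfMoment q B 0 (n + 1) * (1 - (q : ℂ) ^ (n + 1) * B) =
      selfMoment q B 0 n * (conj B - (q : ℂ) ^ (n + 1)) := by
  have h := circleIntegral_zpow_mul_thetaQuot_succ hq0 hq1 hB n
  have hi : ∀ n : ℤ, CircleIntegrable (fun z => z ^ n * thetaQuot q B z) 0 1 := fun n => by
    refine ContinuousOn.circleIntegrable zero_le_one fun z hz => ?_
    have hz : ‖z‖ = 1 := by simpa using hz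
    have hz0 : z ≠ 0 := by
      rintro rfl
      simp at hz
    exact ((continuousAt_zpow₀ z n (Or.inl hz0)).mul
      (continuousAt_thetaQuot hq0 hq1 hB hz)).continuousWithinAt
  have h1 : (∮ z in C(0, 1), z ^ n * (thetaQuot q B z * (1 - conj B * z⁻¹))) =
      (∮ z in C(0, 1), z ^ n * thetaQuot q B z) -
        conj B * ∮ z in C(0, 1), z ^ (n - 1) * thetaQuot q B z := by
    have hc : CircleIntegrable (fun z => conj B * (z ^ (n - 1) * thetaQuot q B z)) 0 1 :=
      (hi (n - 1)).const_smul (a := conj B)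
    rw [← circleIntegral.integral_const_mul, ← circleIntegral.integral_sub (hi n) hc]
    refine circleIntegral.integral_congr zero_le_one fun z hz => ?_
    have hz : ‖z‖ = 1 := by simpa using hz
    have hz0 : z ≠ 0 := by
      rintro rfl
      simp at hz
    simp only [zpow_sub₀ hz0, zpow_one]
    field_simp
  have h2 : (∮ z in C(0, 1), z ^ n * (-(z⁻¹ * (thetaQuot q B z * (1 - B * z))))) =
      B * (∮ z in C(0, 1), z ^ n * thetaQuot q B z) -
        ∮ z in C(0, 1), z ^ (n - 1) * thetaQuot q B z := by
    have hc : CircleIntegrable (fun z => B * (z ^ n * thetaQuot q B z)) 0 1 :=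
      (hi n).const_smul (a := B)
    rw [← circleIntegral.integral_const_mul, ← circleIntegral.integral_sub hc (hi (n - 1))]
    refine circleIntegral.integral_congr zero_le_one fun z hz => ?_
    have hz : ‖z‖ = 1 := by simpa using hz
    have hz0 : z ≠ 0 := by
      rintro rfl
      simp at hz
    simp only [zpow_sub₀ hz0, zpow_one]
    field_simp
    ring
  rw [h1, h2, circleIntegral_zpow_eq_selfMoment, circleIntegral_zpow_eq_selfMoment,
    sub_add_cancel] at h
  refine mul_left_cancel₀ Complex.I_ne_zero ?_
  linear_combination h

/-- The three-term recurrence raises `p`, so the induction on `k` needs the formula for all `p ≥ 0`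
at once; the moment recurrence brings `p + 1` back to `p`. -/
theorem selfMoment_natCast (hq0 : 0 < q) (hq1 : q < 1) (hB : ‖B‖ < 1) (k p : ℕ) :
    selfMoment q B k p = selfMoment q B 0 p *
      (qPoch q (B * conj B) k * qPoch q ((q : ℂ) ^ (p + 1)) k /
        qPoch q ((q : ℂ) ^ (p + 1) * B) k) := by
  have hne : ∀ n i : ℕ, 1 - (q : ℂ) ^ n * B * (q : ℂ) ^ i ≠ 0 := fun n i => by
    rw [mul_comm ((q : ℂ) ^ n), mul_assoc, ← pow_add]
    exact one_sub_ne_zero_of_norm_lt_one (norm_mul_pow_lt_one hq0 hq1 hB _)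
  have hrec : ∀ p : ℕ, selfMoment q B 0 (p + 1 : ℕ) =
      selfMoment q B 0 p * ((conj B - (q : ℂ) ^ (p + 1)) / (1 - (q : ℂ) ^ (p + 1) * B)) := by
    intro p
    have h := selfMoment_zero_succ hq0 hq1 hB p
    have h0 := hne (p + 1) 0
    rw [pow_zero, mul_one] at h0
    rw [← mul_div_assoc, eq_div_iff h0]
    exact_mod_cast h
  induction k using Nat.twoStepInduction generalizing p with
  | zero => simp [qPoch_zero]
  | one =>
    have h := selfMoment_one hq0 hq1 hB p
    rw [← Nat.cast_succ, Nat.succ_eq_add_one, hrec p] at h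
    rw [h]
    have h0 := hne (p + 1) 0
    simp only [pow_zero, mul_one] at h0
    simp only [qPoch, Finset.prod_range_one, pow_zero, mul_one]
    generalize (q : ℂ) ^ (p + 1) = x at h0 ⊢
    rw [mul_comm x] at h0 ⊢
    field_simp
    ring
  | more k h1 h2 =>
    have h := selfMoment_add_two hq0 hq1 hB k p
    rw [← Nat.cast_succ, Nat.succ_eq_add_one, h2, h2, h1, hrec p] at h
    rw [h]
    have hD : qPoch q ((q : ℂ) ^ (p + 1 + 1) * B) k ≠ 0 :=
      Finset.prod_ne_zero_iff.2 fun i _ => hne _ i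
    have e1 := hne (p + 1) 0
    have e2 := hne (p + 1) (k + 1)
    simp only [pow_zero, mul_one] at e1
    have s1 : (q : ℂ) ^ (p + 1) * q = (q : ℂ) ^ (p + 1 + 1) := rfl
    have s2 : (q : ℂ) ^ (p + 1) * B * q = (q : ℂ) ^ (p + 1 + 1) * B := by ring
    rw [qPoch_succ' q ((q : ℂ) ^ (p + 1)) (k + 1), qPoch_succ' q ((q : ℂ) ^ (p + 1)) k,
      qPoch_succ' q ((q : ℂ) ^ (p + 1) * B) (k + 1), qPoch_succ' q ((q : ℂ) ^ (p + 1) * B) k,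
      s1, s2, qPoch_succ q _ (k + 1), qPoch_succ q (B * conj B) k,
      qPoch_succ q ((q : ℂ) ^ (p + 1 + 1)) k, qPoch_succ q ((q : ℂ) ^ (p + 1 + 1) * B) k]
    have s3 : 1 - (q : ℂ) ^ (p + 1 + 1) * (q : ℂ) ^ k =
        1 - (q : ℂ) ^ (p + 1) * (q : ℂ) ^ (k + 1) := by ring
    have s4 : 1 - (q : ℂ) ^ (p + 1 + 1) * B * (q : ℂ) ^ k =
        1 - (q : ℂ) ^ (p + 1) * B * (q : ℂ) ^ (k + 1) := by ring
    rw [s3, s4]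
    generalize qPoch q ((q : ℂ) ^ (p + 1 + 1) * B) k = D at hD ⊢
    generalize qPoch q ((q : ℂ) ^ (p + 1 + 1)) k = Y
    generalize qPoch q (B * conj B) k = P
    generalize (q : ℂ) ^ (p + 1) = x at e1 e2 ⊢
    rw [pow_succ] at e2 ⊢
    generalize (q : ℂ) ^ k = v at e2 ⊢
    generalize hd : 1 - x * B * (v * q) = d at e2 ⊢
    generalize he : 1 - x * B = e at e1 ⊢
    field_simp
    rw [← hd]
    ring

theorem conj_eval_selfRecip (q : ℝ) (B : ℂ) (k : ℕ) {z : ℂ} (hz : ‖z‖ = 1) :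
    conj ((selfRecip q B k).eval z) = z⁻¹ ^ k * (selfRecip q B k).eval z := by
  have hz0 : z ≠ 0 := by
    rintro rfl
    simp at hz
  have hc : conj z = z⁻¹ := (Complex.inv_eq_conj hz).symm
  induction k using Nat.twoStepInduction with
  | zero => simp [selfRecip]
  | one =>
    simp [selfRecip, hc]
    field_simp
    ring
  | more k h1 h2 =>
    simp only [selfRecip, eval_sub, eval_mul, eval_add, eval_C, eval_X]
    simp only [map_sub, map_mul, map_add, h1, h2, hc, map_one, map_pow, Complex.conj_conj, Complex.conj_ofReal]
    have : z⁻¹ * z = 1 := inv_mul_cancel₀ hz0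
    generalize z⁻¹ = w at *
    rw [pow_add, pow_succ]
    have e : w ^ k * w ^ 2 * z = w ^ k * w := by
      linear_combination (w ^ k * w) * this
    linear_combination (-(1 - B * (q : ℂ) ^ (k + 1)) * (selfRecip q B (k + 1)).eval z +
      (1 - (q : ℂ) ^ (k + 1)) * (1 - B * conj B * (q : ℂ) ^ k) * (selfRecip q B k).eval z) * e

/-- On the circle `conj S_k = z^{-k} S_k` and `conj F = -z^{-1} F`. The resulting reflection
exchanges the exponents `-1` and `-k`, and also `0` and `-k-1`. -/
theorem conj_selfMoment (hq0 : 0 < q) (hq1 : q < 1) (k : ℕ) (p : ℤ) :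
    conj (selfMoment q B k p) = -selfMoment q B k (-p - k - 1) := by
  unfold selfMoment
  rw [← intervalIntegral.integral_neg, intervalIntegral.integral_of_le Real.two_pi_pos.le,
    intervalIntegral.integral_of_le Real.two_pi_pos.le, ← integral_conj]
  congr 1 with θ
  have hz := Complex.norm_exp_ofReal_mul_I θ
  have hz0 : Complex.exp (θ * Complex.I) ≠ 0 := Complex.exp_ne_zero _
  generalize Complex.exp (θ * Complex.I) = z at *
  have hc : conj z = z⁻¹ := (Complex.inv_eq_conj hz).symm
  rw [map_mul, map_mul, map_zpow₀, conj_eval_selfRecip q B k hz, conj_thetaQuot hq0 hq1 B hz, hc,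
    zpow_sub₀ hz0, zpow_sub₀ hz0, zpow_neg, zpow_one, inv_zpow, zpow_natCast, inv_pow]
  field_simp

theorem selfMoment_zero_right (hq0 : 0 < q) (hq1 : q < 1) (hB : ‖B‖ < 1) (k : ℕ) :
    selfMoment q B k 0 = selfMoment q B 0 0 *
      (qPoch q (B * conj B) k * qPoch q q k / qPoch q (q * B) k) := by
  have := selfMoment_natCast hq0 hq1 hB k 0
  simpa using this

theorem one_sub_mul_selfMoment_zero_right (hq0 : 0 < q) (hq1 : q < 1) (hB : ‖B‖ < 1) (k : ℕ) :
    (1 - B * (q : ℂ) ^ (k + 1)) * selfMoment q B (k + 1) 0 =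
      (1 - (q : ℂ) ^ (k + 1)) * (1 - B * conj B * (q : ℂ) ^ k) * selfMoment q B k 0 := by
  have hB' : ‖(q : ℂ) * B‖ < 1 := norm_mul_lt_one (norm_ofReal_lt_one hq0 hq1) hB.le
  have h0 := qPoch_ne_zero hq0 hq1 hB' k
  have h1 := one_sub_ne_zero_of_norm_lt_one (norm_mul_pow_lt_one hq0 hq1 hB' k)
  rw [selfMoment_zero_right hq0 hq1 hB (k + 1), selfMoment_zero_right hq0 hq1 hB k, qPoch_succ,
    qPoch_succ, qPoch_succ, show (1 - B * (q : ℂ) ^ (k + 1)) = 1 - q * B * (q : ℂ) ^ k by ring,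
    show (1 - (q : ℂ) ^ (k + 1)) = 1 - q * (q : ℂ) ^ k by ring]
  generalize 1 - (q : ℂ) * B * (q : ℂ) ^ k = w at h1 ⊢
  field_simp

/-- The exponent `-1` is handled by the three-term recurrence, whose two terms at exponent `0`
cancel by `one_sub_mul_selfMoment_zero_right`. Reflection gives the exponent `-k`, and for those in
between every term of the recurrence already vanishes. -/
theorem selfMoment_eq_zero (hq0 : 0 < q) (hq1 : q < 1) (hB : ‖B‖ < 1) (k m : ℕ) (hm : 1 ≤ m)
    (hmk : m ≤ k) : selfMoment q B k (-m) = 0 := by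
  have hfirst : ∀ k, selfMoment q B (k + 1) (-1) = 0 → selfMoment q B (k + 2) (-1) = 0 := by
    intro k h
    rw [selfMoment_add_two hq0 hq1 hB, h, neg_add_cancel, mul_zero, zero_add,
      one_sub_mul_selfMoment_zero_right hq0 hq1 hB, sub_self]
  have hone : selfMoment q B 1 (-1) = 0 := by
    -- At `n = -1` the power `q^{n+1}` is `1`, and the moment recurrence is exactly the vanishing
    -- for `k = 1`.
    have h := selfMoment_zero_succ hq0 hq1 hB (-1)
    rw [selfMoment_one hq0 hq1 hB]
    simp only [neg_add_cancel, zpow_zero, one_mul] at h ⊢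
    linear_combination h
  have hlast : ∀ k, selfMoment q B (k + 1) (-1) = 0 →
      selfMoment q B (k + 1) (-(k + 1 : ℕ)) = 0 := by
    intro k h
    have h1 := conj_selfMoment (B := B) hq0 hq1 (k + 1) (-1)
    rw [h, map_zero, zero_eq_neg] at h1
    rw [← h1]
    congr 1
    push_cast
    ring
  induction k using Nat.twoStepInduction generalizing m with
  | zero => omega
  | one =>
    obtain rfl : m = 1 := by omega
    exact_mod_cast hone
  | more k h1 h2 =>
    have hk : selfMoment q B (k + 2) (-1) = 0 :=
      hfirst k (by exact_mod_cast h2 1 le_rfl (by omega))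
    rcases Nat.lt_or_ge 1 m with hm1 | hm1
    · rcases Nat.lt_or_ge m (k + 2) with hmk' | hmk'
      · obtain ⟨n, rfl⟩ : ∃ n, m = n + 1 := ⟨m - 1, by omega⟩
        rw [selfMoment_add_two hq0 hq1 hB, h2 (n + 1) hm (by omega),
          show -((n + 1 : ℕ) : ℤ) + 1 = -(n : ℤ) by push_cast; ring,
          h2 n (by omega) (by omega), h1 n (by omega) (by omega)]
        ring
      · obtain rfl : m = k + 1 + 1 := by omega
        exact hlast (k + 1) hk
    · obtain rfl : m = 1 := by omega
      exact_mod_cast hk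

end Moments

/-! ### Orthogonal polynomials for a measure integrating all products `conj(f) g` -/

section OPUC

variable {μ : Measure ℂ}

theorem conj_circleInner (μ : Measure ℂ) (f g : ℂ[X]) :
    conj (circleInner μ f g) = circleInner μ g f := by
  unfold circleInner
  rw [← integral_conj]
  simp [mul_comm]

theorem circleInner_eq_zero_symm {f g : ℂ[X]} (h : circleInner μ f g = 0) :
    circleInner μ g f = 0 := by
  rw [← conj_circleInner, h, map_zero]

/-- `circleInner μ f` as a linear functional. -/
noncomputable def circleInnerLin
    (hI : ∀ f g : ℂ[X], Integrable (fun ζ => conj (f.eval ζ) * g.eval ζ) μ) (f : ℂ[X]) :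
    ℂ[X] →ₗ[ℂ] ℂ where
  toFun := circleInner μ f
  map_add' g h := by
    simp only [circleInner, eval_add, mul_add]
    exact integral_add (hI f g) (hI f h)
  map_smul' a g := by
    simp only [circleInner, eval_smul, smul_eq_mul, mul_left_comm _ a, RingHom.id_apply]
    exact integral_const_mul _ _

theorem circleInner_sub_right
    (hI : ∀ f g : ℂ[X], Integrable (fun ζ => conj (f.eval ζ) * g.eval ζ) μ)
    (f g h : ℂ[X]) :
    circleInner μ f (g - h) = circleInner μ f g - circleInner μ f h :=
  (circleInnerLin hI f).map_sub g h

theorem circleInner_C_mul_right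
    (hI : ∀ f g : ℂ[X], Integrable (fun ζ => conj (f.eval ζ) * g.eval ζ) μ)
    (a : ℂ) (f g : ℂ[X]) :
    circleInner μ f (C a * g) = a * circleInner μ f g := by
  rw [← smul_eq_C_mul]
  exact (circleInnerLin hI f).map_smul a g

theorem circleInner_C_mul_left
    (hI : ∀ f g : ℂ[X], Integrable (fun ζ => conj (f.eval ζ) * g.eval ζ) μ)
    (a : ℂ) (f g : ℂ[X]) :
    circleInner μ (C a * f) g = conj a * circleInner μ f g := by
  rw [← conj_circleInner, circleInner_C_mul_right hI, map_mul, conj_circleInner]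

theorem circleInner_eq_zero_of_degree_lt
    (hI : ∀ f g : ℂ[X], Integrable (fun ζ => conj (f.eval ζ) * g.eval ζ) μ)
    {f P : ℂ[X]} {k : ℕ}
    (hf : ∀ j < k, circleInner μ (X ^ j) f = 0) (hP : P.degree < k) :
    circleInner μ f P = 0 := by
  rcases eq_or_ne P 0 with rfl | hP0
  · exact (circleInnerLin hI f).map_zero
  have hd : P.natDegree < k := (natDegree_lt_iff_degree_lt hP0).2 hP
  rw [P.as_sum_range_C_mul_X_pow]
  change circleInnerLin hI f _ = 0
  rw [map_sum]
  refine Finset.sum_eq_zero fun i hi => ?_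
  change circleInner μ f _ = 0
  rw [circleInner_C_mul_right hI,
    circleInner_eq_zero_symm (hf i (by have := Finset.mem_range.1 hi; omega)), mul_zero]

theorem isMonicOPUC_of_forall_pow
    (hI : ∀ f g : ℂ[X], Integrable (fun ζ => conj (f.eval ζ) * g.eval ζ) μ)
    {Φ : ℕ → ℂ[X]}
    (hm : ∀ k, (Φ k).Monic ∧ (Φ k).natDegree = k)
    (h0 : ∀ k, ∀ j < k, circleInner μ (X ^ j) (Φ k) = 0)
    (hne : ∀ k, circleInner μ (X ^ k) (Φ k) ≠ 0) :
    IsMonicOPUC μ Φ ∧ ∀ k, circleInner μ (Φ k) (Φ k) = circleInner μ (X ^ k) (Φ k) := by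
  have hdeg : ∀ k, (Φ k).degree = k := fun k => by
    rw [degree_eq_natDegree (hm k).1.ne_zero, (hm k).2]
  have hlt : ∀ j k, j < k → circleInner μ (Φ k) (Φ j) = 0 := fun j k hjk =>
    circleInner_eq_zero_of_degree_lt hI (h0 k) (by rw [hdeg]; exact_mod_cast hjk)
  have hself : ∀ k, circleInner μ (Φ k) (Φ k) = circleInner μ (X ^ k) (Φ k) := fun k => by
    have h : circleInner μ (Φ k) (Φ k - X ^ k) = 0 := by
      refine circleInner_eq_zero_of_degree_lt hI (h0 k) ?_
      rw [← hdeg k]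
      exact degree_sub_lt_left ((hdeg k).trans (degree_X_pow k).symm) (hm k).1.ne_zero
        ((hm k).1.leadingCoeff.trans (monic_X_pow k).leadingCoeff.symm)
    rw [circleInner_sub_right hI, sub_eq_zero] at h
    rw [← conj_circleInner μ (Φ k) (X ^ k), ← h, conj_circleInner]
  refine ⟨⟨hm, fun j k hjk => ?_, fun k => by rw [hself]; exact hne k⟩, hself⟩
  rcases lt_or_gt_of_ne hjk with h | h
  · exact circleInner_eq_zero_symm (hlt j k h)
  · exact hlt k j h

theorem IsMonicOPUC.circleInner_eq_zero
    (hI : ∀ f g : ℂ[X], Integrable (fun ζ => conj (f.eval ζ) * g.eval ζ) μ)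
    {Φ : ℕ → ℂ[X]} (hΦ : IsMonicOPUC μ Φ) {k : ℕ} {P : ℂ[X]}
    (hP : P.degree < k) : circleInner μ (Φ k) P = 0 := by
  suffices H : ∀ n ≤ k, ∀ P : ℂ[X], P.degree < n → circleInner μ (Φ k) P = 0 from
    H k le_rfl P hP
  intro n
  induction n with
  | zero =>
    intro _ P hP
    obtain rfl : P = 0 := by simpa using hP
    exact (circleInnerLin hI _).map_zero
  | succ n ih =>
    intro hn P hP
    have h := ih (by omega) (P - C (P.coeff n) * Φ n) <| by
      rw [degree_lt_iff_coeff_zero] at hP ⊢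
      intro m hm
      rw [coeff_sub, coeff_C_mul]
      rcases hm.eq_or_lt with rfl | hm
      · have := (hΦ.1 n).1.coeff_natDegree
        rw [(hΦ.1 n).2] at this
        rw [this, mul_one, sub_self]
      · rw [hP m hm, coeff_eq_zero_of_natDegree_lt (p := Φ n) (by rwa [(hΦ.1 n).2]), mul_zero, sub_zero]
    rwa [circleInner_sub_right hI, circleInner_C_mul_right hI, hΦ.2.1 k n (by omega), mul_zero,
      sub_zero] at h

/-- A nonzero difference `E` of the two `k`-th polynomials has degree `d < k`, so it is orthogonal
to `Φ_d`. But `E` is its leading coefficient times `Φ_d` plus lower terms, which forces `⟨Φ_d, Φ_d⟩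
= 0`. -/
theorem IsMonicOPUC.unique
    (hI : ∀ f g : ℂ[X], Integrable (fun ζ => conj (f.eval ζ) * g.eval ζ) μ)
    {Φ Ψ : ℕ → ℂ[X]} (hΦ : IsMonicOPUC μ Φ) (hΨ : IsMonicOPUC μ Ψ) :
    Ψ = Φ := by
  have hdeg : ∀ {Φ : ℕ → ℂ[X]}, IsMonicOPUC μ Φ → ∀ k, (Φ k).degree = k := fun hΦ k => by
    rw [degree_eq_natDegree (hΦ.1 k).1.ne_zero, (hΦ.1 k).2]
  funext k
  by_contra hne
  set E := Ψ k - Φ k with hE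
  have hE0 : E ≠ 0 := sub_ne_zero.2 hne
  have hEk : E.degree < k := by
    rw [← hdeg hΨ k]
    exact degree_sub_lt_left ((hdeg hΨ k).trans (hdeg hΦ k).symm) (hΨ.1 k).1.ne_zero
      ((hΨ.1 k).1.leadingCoeff.trans (hΦ.1 k).1.leadingCoeff.symm)
  set d := E.natDegree with hd
  have hdk : d < k := (natDegree_lt_iff_degree_lt hE0).2 hEk
  have hdlt : (Φ d).degree < k := by rw [hdeg hΦ]; exact_mod_cast hdk
  have h1 : circleInner μ (Φ d) E = 0 := by
    rw [hE, circleInner_sub_right hI,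
      circleInner_eq_zero_symm (IsMonicOPUC.circleInner_eq_zero hI hΨ hdlt),
      circleInner_eq_zero_symm (IsMonicOPUC.circleInner_eq_zero hI hΦ hdlt), sub_zero]
  have hlc : E.leadingCoeff ≠ 0 := leadingCoeff_ne_zero.2 hE0
  have h2 : circleInner μ (Φ d) (E - C E.leadingCoeff * Φ d) = 0 := by
    refine IsMonicOPUC.circleInner_eq_zero hI hΦ ?_
    have he : E.degree = (C E.leadingCoeff * Φ d).degree := by
      rw [degree_C_mul hlc, hdeg hΦ, degree_eq_natDegree hE0]
    refine (degree_sub_lt_left he hE0 ?_).trans_eq (degree_eq_natDegree hE0)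
    rw [leadingCoeff_mul, leadingCoeff_C, (hΦ.1 d).1.leadingCoeff, mul_one]
  rw [circleInner_sub_right hI, circleInner_C_mul_right hI, h1, zero_sub, neg_eq_zero] at h2
  exact mul_ne_zero hlc (hΦ.2.2 d) h2

theorem circleInner_self_eq_ofReal (μ : Measure ℂ) (f : ℂ[X]) :
    circleInner μ f f = ((∫ ζ, ‖f.eval ζ‖ ^ 2 ∂μ : ℝ) : ℂ) := by
  rw [circleInner, ← integral_complex_ofReal]
  congr 1 with ζ
  rw [mul_comm, Complex.mul_conj']
  push_cast
  rfl

/-- Here `κ_k = ⟨Φ_k, Φ_k⟩^{-1/2}`. Any orthonormal sequence becomes monic orthogonal after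
rescaling, so uniqueness applies, and positivity of the leading coefficient fixes the square root.
-/
theorem IsMonicOPUC.exists_orthonormal
    (hI : ∀ f g : ℂ[X], Integrable (fun ζ => conj (f.eval ζ) * g.eval ζ) μ)
    {Φ : ℕ → ℂ[X]} (hΦ : IsMonicOPUC μ Φ) :
    ∃ κ : ℕ → ℝ, (∀ k, 0 < κ k) ∧ IsOrthonormalOPUC μ (fun k => C (κ k : ℂ) * Φ k) ∧
      (∀ φ : ℕ → ℂ[X], IsOrthonormalOPUC μ φ → φ = fun k => C (κ k : ℂ) * Φ k) ∧
      ∀ k, (κ k : ℂ) ^ (-2 : ℤ) = circleInner μ (Φ k) (Φ k) := by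
  set r : ℕ → ℝ := fun k => ∫ ζ, ‖(Φ k).eval ζ‖ ^ 2 ∂μ with hr
  have hself : ∀ k, circleInner μ (Φ k) (Φ k) = (r k : ℂ) := fun k =>
    circleInner_self_eq_ofReal μ (Φ k)
  have hpos : ∀ k, 0 < r k := fun k => by
    refine lt_of_le_of_ne (integral_nonneg fun _ => by positivity) fun h => hΦ.2.2 k ?_
    rw [hself, ← h, Complex.ofReal_zero]
  have hκ : ∀ k, 0 < (√(r k))⁻¹ := fun k => inv_pos.2 (Real.sqrt_pos.2 (hpos k))
  have hsq : ∀ k, (√(r k))⁻¹ * ((√(r k))⁻¹ * r k) = 1 := fun k => by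
    have h := Real.mul_self_sqrt (hpos k).le
    have h0 := (Real.sqrt_pos.2 (hpos k)).ne'
    field_simp
    rw [sq, h]
  refine ⟨fun k => (√(r k))⁻¹, hκ, ⟨fun k => ⟨?_, _, hκ k, ?_⟩, fun j k => ?_⟩,
    fun φ hφ => ?_, fun k => ?_⟩
  · rw [natDegree_C_mul (by exact_mod_cast (hκ k).ne'), (hΦ.1 k).2]
  · rw [leadingCoeff_mul, leadingCoeff_C, (hΦ.1 k).1.leadingCoeff, mul_one]
  · rw [circleInner_C_mul_left hI, circleInner_C_mul_right hI, Complex.conj_ofReal]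
    split_ifs with h
    · subst h
      rw [hself]
      exact_mod_cast hsq j
    · rw [hΦ.2.1 j k h, mul_zero, mul_zero]
  · choose hdeg κ hκ' hlc using hφ.1
    have hκ0 : ∀ k, (κ k : ℂ) ≠ 0 := fun k => by exact_mod_cast (hκ' k).ne'
    have hΨ : IsMonicOPUC μ (fun k => C (κ k : ℂ)⁻¹ * φ k) := by
      refine ⟨fun k => ⟨?_, ?_⟩, fun j k hjk => ?_, fun k => ?_⟩
      · rw [Monic, leadingCoeff_mul, leadingCoeff_C, hlc, inv_mul_cancel₀ (hκ0 k)]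
      · rw [natDegree_C_mul (inv_ne_zero (hκ0 k)), hdeg]
      · rw [circleInner_C_mul_left hI, circleInner_C_mul_right hI, hφ.2 j k, if_neg hjk, mul_zero,
          mul_zero]
      · rw [circleInner_C_mul_left hI, circleInner_C_mul_right hI, hφ.2 k k, if_pos rfl]
        simpa using hκ0 k
    have hφΦ : ∀ k, φ k = C (κ k : ℂ) * Φ k := fun k => by
      rw [← IsMonicOPUC.unique hI hΦ hΨ, ← mul_assoc, ← C_mul, mul_inv_cancel₀ (hκ0 k), C_1,
        one_mul]
    funext k
    have h1 := hφ.2 k k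
    rw [if_pos rfl, hφΦ k, circleInner_C_mul_left hI, circleInner_C_mul_right hI, hself,
      Complex.conj_ofReal] at h1
    have h2 : κ k * (κ k * r k) = 1 := by exact_mod_cast h1
    have h3 : √(r k) = (κ k)⁻¹ := by
      rw [Real.sqrt_eq_iff_mul_self_eq (hpos k).le (inv_pos.2 (hκ' k)).le]
      have := (hκ' k).ne'
      field_simp
      linarith
    simp only [hφΦ k, h3, inv_inv]
  · rw [hself, zpow_neg]
    push_cast
    rw [inv_zpow, inv_inv]
    exact_mod_cast Real.sq_sqrt (hpos k).le

end OPUC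

/-! ### The measure, its monic polynomials and their norms -/

section HatMeasure

variable {q lam eta rho : ℝ}

theorem hatWeight_nonneg (ζ : ℂ) : 0 ≤ hatWeight q lam eta ζ := by
  unfold hatWeight
  positivity

theorem continuous_hatWeight_exp (hq0 : 0 < q) (hq1 : q < 1) (hlam : 0 < lam) :
    Continuous fun θ : ℝ => hatWeight q lam eta (Complex.exp (θ * Complex.I)) := by
  have hd := (differentiable_qPochInf hq0 hq1).continuous
  have hB := norm_cpow_bParam_lt_one (eta := eta) hq0 hq1 hlam
  unfold hatWeight
  refine Continuous.div (by fun_prop) (by fun_prop) fun θ => ?_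
  exact pow_ne_zero _ (norm_ne_zero_iff.2 (qPochInf_ne_zero_of_norm_lt_one hq0 hq1
    (norm_mul_lt_one hB (Complex.norm_exp_ofReal_mul_I θ).le)))

theorem measurable_hatDensity (hq0 : 0 < q) (hq1 : q < 1) (hlam : 0 < lam) :
    Measurable fun θ : ℝ => ENNReal.ofReal
      (rho / (2 * Real.pi) * hatWeight q lam eta (Complex.exp (θ * Complex.I))) :=
  ((continuous_hatWeight_exp hq0 hq1 hlam).const_mul _).measurable.ennreal_ofReal

theorem integrable_hatMeasure (hq0 : 0 < q) (hq1 : q < 1) (hlam : 0 < lam) {h : ℂ → ℂ}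
    (hc : Continuous h) : Integrable h (hatMeasure q lam eta rho) := by
  have he : Continuous fun θ : ℝ => Complex.exp (θ * Complex.I) := by fun_prop
  have hw := continuous_hatWeight_exp (eta := eta) hq0 hq1 hlam
  unfold hatMeasure
  rw [integrable_map_measure hc.aestronglyMeasurable he.aemeasurable,
    integrable_withDensity_iff_integrable_smul' (measurable_hatDensity hq0 hq1 hlam)
      (.of_forall fun _ => ENNReal.ofReal_lt_top)]
  refine ContinuousOn.integrableOn_Icc (Continuous.continuousOn ?_)
  simp only [ENNReal.toReal_ofReal']
  have := hc.comp he
  fun_prop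

theorem integral_hatMeasure (hq0 : 0 < q) (hq1 : q < 1) (hlam : 0 < lam) (hrho : 0 < rho)
    {h : ℂ → ℂ} (hc : Continuous h) :
    ∫ ζ, h ζ ∂hatMeasure q lam eta rho =
      ((rho / (2 * Real.pi) : ℝ) : ℂ) * ∫ θ in (0 : ℝ)..2 * Real.pi,
        (hatWeight q lam eta (Complex.exp (θ * Complex.I)) : ℂ) *
          h (Complex.exp (θ * Complex.I)) := by
  have he : Continuous fun θ : ℝ => Complex.exp (θ * Complex.I) := by fun_prop
  unfold hatMeasure
  rw [integral_map he.aemeasurable hc.aestronglyMeasurable,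
    integral_withDensity_eq_integral_toReal_smul (measurable_hatDensity hq0 hq1 hlam)
      (.of_forall fun _ => ENNReal.ofReal_lt_top),
    integral_Icc_eq_integral_Ioc, ← intervalIntegral.integral_of_le Real.two_pi_pos.le,
    ← intervalIntegral.integral_const_mul]
  refine intervalIntegral.integral_congr fun θ _ => ?_
  have h0 : 0 ≤ rho / (2 * Real.pi) * hatWeight q lam eta (Complex.exp (θ * Complex.I)) :=
    mul_nonneg (by positivity) (hatWeight_nonneg _)
  simp only [ENNReal.toReal_ofReal h0, Complex.real_smul]
  push_cast
  ring

theorem continuous_conj_eval_mul_eval (f g : ℂ[X]) :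
    Continuous fun ζ : ℂ => conj (f.eval ζ) * g.eval ζ :=
  (Complex.continuous_conj.comp f.continuous).mul g.continuous

theorem integrable_circleInner_hatMeasure (hq0 : 0 < q) (hq1 : q < 1) (hlam : 0 < lam)
    (f g : ℂ[X]) :
    Integrable (fun ζ => conj (f.eval ζ) * g.eval ζ) (hatMeasure q lam eta rho) :=
  integrable_hatMeasure hq0 hq1 hlam
    (continuous_conj_eval_mul_eval f g)

theorem hatWeight_pos (hq0 : 0 < q) (hq1 : q < 1) (hlam : 0 < lam) {ζ : ℂ} (hζ : ‖ζ‖ = 1)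
    (hne : ζ ≠ 1) : 0 < hatWeight q lam eta ζ := by
  have hB := norm_cpow_bParam_lt_one (eta := eta) hq0 hq1 hlam
  have h1 : qPochInf q ζ ≠ 0 := by
    rw [qPochInf_eq_mul hq0 hq1]
    refine mul_ne_zero (sub_ne_zero.2 hne.symm) (qPochInf_ne_zero_of_norm_lt_one hq0 hq1 ?_)
    exact norm_mul_lt_one (norm_ofReal_lt_one hq0 hq1) hζ.le
  have h2 : qPochInf q ((q : ℂ) ^ bParam lam eta * ζ) ≠ 0 :=
    qPochInf_ne_zero_of_norm_lt_one hq0 hq1 (norm_mul_lt_one hB hζ.le)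
  have := norm_pos_iff.2 h1
  have := norm_pos_iff.2 h2
  unfold hatWeight
  positivity

/-- The density is continuous and positive on the circle away from `ζ = 1`, that is for `0 < θ <
2π`. -/
theorem circleInner_one_one_ne_zero (hq0 : 0 < q) (hq1 : q < 1) (hlam : 0 < lam)
    (hrho : 0 < rho) : circleInner (hatMeasure q lam eta rho) 1 1 ≠ 0 := by
  unfold circleInner
  rw [integral_hatMeasure hq0 hq1 hlam hrho
    (continuous_conj_eval_mul_eval 1 1)]
  simp only [eval_one, map_one, mul_one]
  rw [intervalIntegral.integral_ofReal, ← Complex.ofReal_mul, Complex.ofReal_ne_zero]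
  refine (mul_pos (by positivity) ?_).ne'
  refine intervalIntegral.intervalIntegral_pos_of_pos_on
    ((continuous_hatWeight_exp hq0 hq1 hlam).intervalIntegrable _ _) (fun θ hθ => ?_)
    Real.two_pi_pos
  refine hatWeight_pos hq0 hq1 hlam (Complex.norm_exp_ofReal_mul_I θ) fun h => ?_
  have h1 := congrArg Complex.re h
  rw [Complex.exp_ofReal_mul_I_re, Complex.one_re] at h1
  obtain ⟨n, hn⟩ := (Real.cos_eq_one_iff θ).1 h1
  rw [← hn] at hθ
  have hp := Real.two_pi_pos
  have hn0 : (0 : ℝ) < n := pos_of_mul_pos_left hθ.1 hp.le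
  have hn1 : (n : ℝ) < 1 := by
    by_contra hge
    exact absurd hθ.2 (not_lt.2 (le_mul_of_one_le_left hp.le (not_lt.1 hge)))
  have h2 : (0 : ℤ) < n := by exact_mod_cast hn0
  have h3 : n < (1 : ℤ) := by exact_mod_cast hn1
  omega

/-- The quotient
`(S_{k+1} - 2 (1 - ℓ_{k+1}) (1 - q^{λ+k} cos η_q) S_k) / ((q^b; q)_{k+1} (z - 1))`, where `S_k` is
`selfRecip q (q^b) k`. -/
noncomputable def hatPhi (q lam eta : ℝ) (k : ℕ) : ℂ[X] :=
  C (qPoch q ((q : ℂ) ^ bParam lam eta) (k + 1))⁻¹ *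
    ((selfRecip q ((q : ℂ) ^ bParam lam eta) (k + 1) -
      C (2 * (1 - (minParam q lam eta k : ℂ)) * (1 - (q : ℂ) ^ k * (qCos q lam eta : ℂ))) *
        selfRecip q ((q : ℂ) ^ bParam lam eta) k) /ₘ (X - C 1))

/-- The division is exact because the coefficient of `S_k` is the ratio from
`eval_one_selfRecip_succ`. -/
theorem X_sub_one_mul_hatPhi (hq0 : 0 < q) (hq1 : q < 1) (hlam : 0 < lam) (k : ℕ) :
    (X - C 1) * hatPhi q lam eta k = C (qPoch q ((q : ℂ) ^ bParam lam eta) (k + 1))⁻¹ *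
      (selfRecip q ((q : ℂ) ^ bParam lam eta) (k + 1) -
        C (2 * (1 - (minParam q lam eta k : ℂ)) * (1 - (q : ℂ) ^ k * (qCos q lam eta : ℂ))) *
          selfRecip q ((q : ℂ) ^ bParam lam eta) k) := by
  rw [hatPhi, mul_left_comm, mul_divByMonic_eq_iff_isRoot.2]
  rw [IsRoot.def, eval_sub, eval_mul, eval_C, eval_one_selfRecip_succ hq0 hq1 hlam, sub_self]

theorem hatPhi_monic (hq0 : 0 < q) (hq1 : q < 1) (hlam : 0 < lam) (k : ℕ) :
    (hatPhi q lam eta k).Monic ∧ (hatPhi q lam eta k).natDegree = k := by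
  have hB := norm_cpow_bParam_lt_one (eta := eta) hq0 hq1 hlam
  have h := X_sub_one_mul_hatPhi (eta := eta) hq0 hq1 hlam k
  have hne := qPoch_ne_zero hq0 hq1 hB (k + 1)
  have hle : ((X - C 1) * hatPhi q lam eta k).natDegree ≤ k + 1 := by
    rw [h]
    refine (natDegree_C_mul_le _ _).trans ((natDegree_sub_le _ _).trans (max_le ?_ ?_))
    · exact natDegree_selfRecip_le _ _ _
    · exact (natDegree_C_mul_le _ _).trans ((natDegree_selfRecip_le _ _ _).trans (by omega))
  have hco : ((X - C 1) * hatPhi q lam eta k).coeff (k + 1) = 1 := by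
    rw [h, coeff_C_mul, coeff_sub, coeff_C_mul, coeff_selfRecip_self hq0 hq1,
      coeff_eq_zero_of_natDegree_lt (p := selfRecip q _ k)
        (Nat.lt_succ_of_le (natDegree_selfRecip_le _ _ _)), mul_zero, sub_zero,
      inv_mul_cancel₀ hne]
  have hmon : ((X - C 1) * hatPhi q lam eta k).Monic :=
    monic_of_natDegree_le_of_coeff_eq_one _ hle hco
  have hX : (X - C (1 : ℂ)).Monic := monic_X_sub_C 1
  have hm : (hatPhi q lam eta k).Monic := hX.of_mul_monic_left hmon
  refine ⟨hm, ?_⟩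
  have hd : ((X - C 1) * hatPhi q lam eta k).natDegree = k + 1 :=
    le_antisymm hle (le_natDegree_of_ne_zero (by rw [hco]; exact one_ne_zero))
  rw [hX.natDegree_mul hm, natDegree_X_sub_C] at hd
  omega

/-- The factor `1 - 1/ζ = ζ^{-1} (ζ - 1)` of the weight clears the denominator of `Φ_k`; its
`ζ^{-1}` shifts the exponent from `-j` to `-(j + 1)`. -/
theorem circleInner_X_pow_hatPhi (hq0 : 0 < q) (hq1 : q < 1) (hlam : 0 < lam) (hrho : 0 < rho)
    (j k : ℕ) :
    circleInner (hatMeasure q lam eta rho) (X ^ j) (hatPhi q lam eta k) =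
      ((rho / (2 * Real.pi) : ℝ) : ℂ) * ((qPoch q ((q : ℂ) ^ bParam lam eta) (k + 1))⁻¹ *
        (selfMoment q ((q : ℂ) ^ bParam lam eta) (k + 1) (-(j + 1 : ℕ)) -
          2 * (1 - (minParam q lam eta k : ℂ)) * (1 - (q : ℂ) ^ k * (qCos q lam eta : ℂ)) *
            selfMoment q ((q : ℂ) ^ bParam lam eta) k (-(j + 1 : ℕ)))) := by
  have hB := norm_cpow_bParam_lt_one (eta := eta) hq0 hq1 hlam
  have hi := intervalIntegrable_selfMoment hq0 hq1 hB
  unfold circleInner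
  rw [integral_hatMeasure hq0 hq1 hlam hrho
    (continuous_conj_eval_mul_eval _ _)]
  unfold selfMoment
  congr 1
  rw [← intervalIntegral.integral_const_mul
      (2 * (1 - (minParam q lam eta k : ℂ)) * (1 - (q : ℂ) ^ k * (qCos q lam eta : ℂ))),
    ← intervalIntegral.integral_sub (hi _ _ _ _) ((hi _ _ _ _).const_mul _),
    ← intervalIntegral.integral_const_mul]
  refine intervalIntegral.integral_congr fun θ _ => ?_
  have hz := Complex.norm_exp_ofReal_mul_I θ
  have hz0 : Complex.exp (θ * Complex.I) ≠ 0 := Complex.exp_ne_zero _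
  generalize Complex.exp (θ * Complex.I) = z at *
  have hc : conj z = z⁻¹ := (Complex.inv_eq_conj hz).symm
  have h := congrArg (eval z) (X_sub_one_mul_hatPhi (eta := eta) hq0 hq1 hlam k)
  simp only [eval_mul, eval_sub, eval_X, eval_C] at h
  rw [hatWeight_eq_thetaQuot hq0 hq1 hz, eval_pow, eval_X, map_pow, hc, zpow_neg, zpow_natCast,
    pow_succ, mul_inv, inv_pow]
  have e : (1 - z⁻¹) = z⁻¹ * (z - 1) := by
    field_simp
  rw [e]
  linear_combination (z⁻¹ * thetaQuot q ((q : ℂ) ^ bParam lam eta) z * (z ^ j)⁻¹) * h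

theorem circleInner_X_pow_hatPhi_of_lt (hq0 : 0 < q) (hq1 : q < 1) (hlam : 0 < lam)
    (hrho : 0 < rho) {j k : ℕ} (hjk : j < k) :
    circleInner (hatMeasure q lam eta rho) (X ^ j) (hatPhi q lam eta k) = 0 := by
  have hB := norm_cpow_bParam_lt_one (eta := eta) hq0 hq1 hlam
  rw [circleInner_X_pow_hatPhi hq0 hq1 hlam hrho,
    selfMoment_eq_zero hq0 hq1 hB _ _ (by omega) (by omega),
    selfMoment_eq_zero hq0 hq1 hB _ _ (by omega) (by omega)]
  ring

theorem one_sub_pow_mul_qCos_ne_zero (hq0 : 0 < q) (hq1 : q < 1) (hlam : 0 < lam) (k : ℕ) :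
    1 - (q : ℂ) ^ k * (qCos q lam eta : ℂ) ≠ 0 := by
  exact_mod_cast (sub_pos.2 (pow_mul_qCos_lt_one hq0 hq1 hlam k)).ne'

theorem cpow_bParam_add_one (hq0 : 0 < q) :
    (q : ℂ) ^ (bParam lam eta + 1) = (q : ℂ) ^ bParam lam eta * q := by
  rw [Complex.cpow_add _ _ (by exact_mod_cast hq0.ne'), Complex.cpow_one]

theorem cpow_conj_bParam_add_natCast (hq0 : 0 < q) (k : ℕ) :
    (q : ℂ) ^ (conj (bParam lam eta) + (k : ℂ)) =
      conj ((q : ℂ) ^ bParam lam eta) * (q : ℂ) ^ k := by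
  rw [Complex.cpow_add _ _ (by exact_mod_cast hq0.ne'), Complex.cpow_natCast,
    conj_cpow_bParam hq0]

/-- At exponent `-(k + 1)` the `S_{k+1}` moment vanishes, and reflection expresses the `S_k` moment
through the product formula at exponent `0`. Its unknown constant, and with it `ρ`, is eliminated by
the case `k = 0`, where `Φ_0 = 1`; the integral of `F` is never evaluated. -/
theorem circleInner_X_pow_hatPhi_self (hq0 : 0 < q) (hq1 : q < 1) (hlam : 0 < lam)
    (hrho : 0 < rho) (k : ℕ) :
    circleInner (hatMeasure q lam eta rho) (X ^ k) (hatPhi q lam eta k) =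
      circleInner (hatMeasure q lam eta rho) 1 1 *
        (qPoch q (q : ℂ) k * qPoch q ((q : ℂ) ^ (2 * (lam : ℂ))) k /
          (qPoch q ((q : ℂ) ^ (bParam lam eta + 1)) k *
            qPoch q ((q : ℂ) ^ (conj (bParam lam eta) + 1)) k) *
          ((1 - (q : ℂ) ^ k * (qCos q lam eta : ℂ)) / (1 - (qCos q lam eta : ℂ))) *
          (1 - (minParam q lam eta k : ℂ))) := by
  have hB := norm_cpow_bParam_lt_one (eta := eta) hq0 hq1 hlam
  have hqn := norm_ofReal_lt_one hq0 hq1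
  have hformula : ∀ k, circleInner (hatMeasure q lam eta rho) (X ^ k) (hatPhi q lam eta k) =
      ((rho / (2 * Real.pi) : ℝ) : ℂ) * ((qPoch q ((q : ℂ) ^ bParam lam eta) (k + 1))⁻¹ *
        (2 * (1 - (minParam q lam eta k : ℂ)) * (1 - (q : ℂ) ^ k * (qCos q lam eta : ℂ)) *
          conj (selfMoment q ((q : ℂ) ^ bParam lam eta) k 0))) := fun k => by
    rw [circleInner_X_pow_hatPhi hq0 hq1 hlam hrho, conj_selfMoment hq0 hq1,
      selfMoment_eq_zero hq0 hq1 hB _ _ (by omega) (by omega),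
      show (-0 - (k : ℤ) - 1) = -(k + 1 : ℕ) by push_cast; ring]
    ring
  have hΦ0 : hatPhi q lam eta 0 = 1 :=
    eq_one_of_monic_natDegree_zero (hatPhi_monic hq0 hq1 hlam 0).1 (hatPhi_monic hq0 hq1 hlam 0).2
  have h0 := hformula 0
  rw [pow_zero, hΦ0] at h0
  have hc := one_sub_pow_mul_qCos_ne_zero (eta := eta) hq0 hq1 hlam 0
  have hconj : (q : ℂ) ^ (conj (bParam lam eta) + 1) = conj ((q : ℂ) ^ bParam lam eta) * q := by
    simpa using cpow_conj_bParam_add_natCast (lam := lam) (eta := eta) hq0 1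
  rw [hformula, h0, selfMoment_zero_right hq0 hq1 hB k, cpow_bParam_mul_conj hq0,
    cpow_bParam_add_one hq0, hconj, qPoch_succ' q _ k, qPoch_succ' q _ 0, qPoch_zero]
  simp only [map_mul, map_div₀, conj_qPoch, Complex.conj_ofReal, minParam, pow_zero, one_mul,
    Complex.ofReal_zero, sub_zero, mul_one, mul_comm (q : ℂ)] at hc ⊢
  rw [cpow_two_mul_eq hq0, Complex.conj_ofReal]
  have n0 := one_sub_ne_zero_of_norm_lt_one hB
  have n1 := qPoch_ne_zero hq0 hq1 (norm_mul_lt_one hB hqn.le) k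
  have n2 := qPoch_ne_zero hq0 hq1 (norm_mul_lt_one (B := conj ((q : ℂ) ^ bParam lam eta))
    (by simpa using hB) hqn.le) k
  field_simp

theorem hatPhi_isMonicOPUC (hq0 : 0 < q) (hq1 : q < 1) (hlam : 0 < lam) (hrho : 0 < rho) :
    IsMonicOPUC (hatMeasure q lam eta rho) (hatPhi q lam eta) ∧
      ∀ k, circleInner (hatMeasure q lam eta rho) (hatPhi q lam eta k) (hatPhi q lam eta k) =
        circleInner (hatMeasure q lam eta rho) (X ^ k) (hatPhi q lam eta k) := by
  have hB := norm_cpow_bParam_lt_one (eta := eta) hq0 hq1 hlam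
  have hqn := norm_ofReal_lt_one hq0 hq1
  refine isMonicOPUC_of_forall_pow (integrable_circleInner_hatMeasure hq0 hq1 hlam)
    (hatPhi_monic hq0 hq1 hlam)
    (fun k j hjk => circleInner_X_pow_hatPhi_of_lt hq0 hq1 hlam hrho hjk) fun k => ?_
  have hconj : (q : ℂ) ^ (conj (bParam lam eta) + 1) = conj ((q : ℂ) ^ bParam lam eta) * q := by
    simpa using cpow_conj_bParam_add_natCast (lam := lam) (eta := eta) hq0 1
  have hB2 : ‖(q : ℂ) ^ (2 * (lam : ℂ))‖ < 1 := by
    rw [← cpow_bParam_mul_conj (eta := eta) hq0]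
    exact norm_mul_lt_one hB (by simpa using hB.le)
  rw [circleInner_X_pow_hatPhi_self hq0 hq1 hlam hrho, cpow_bParam_add_one hq0, hconj]
  have hc := one_sub_pow_mul_qCos_ne_zero (eta := eta) hq0 hq1 hlam 0
  rw [pow_zero, one_mul] at hc
  have hl : (1 - (minParam q lam eta k : ℂ)) ≠ 0 := by
    exact_mod_cast (sub_pos.2 (minParam_lt_one hq0 hq1 hlam k)).ne'
  exact mul_ne_zero (circleInner_one_one_ne_zero hq0 hq1 hlam hrho)
    (mul_ne_zero (mul_ne_zero (div_ne_zero
      (mul_ne_zero (qPoch_ne_zero hq0 hq1 hqn k) (qPoch_ne_zero hq0 hq1 hB2 k))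
      (mul_ne_zero (qPoch_ne_zero hq0 hq1 (norm_mul_lt_one hB hqn.le) k)
        (qPoch_ne_zero hq0 hq1 (norm_mul_lt_one (by simpa using hB) hqn.le) k)))
      (div_ne_zero (one_sub_pow_mul_qCos_ne_zero hq0 hq1 hlam k) hc)) hl)

theorem eval_hatPhi (hq0 : 0 < q) (hq1 : q < 1) (hlam : 0 < lam) (k : ℕ) {z : ℂ} (hz : z ≠ 1) :
    (hatPhi q lam eta k).eval z =
      qPoch q (qCos q lam eta : ℂ) (k + 1) / qPoch q ((q : ℂ) ^ bParam lam eta) (k + 1) *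
        ((modR q lam eta (k + 1) z
          - 2 * (1 - (minParam q lam eta k : ℂ)) * modR q lam eta k z) / (z - 1)) := by
  have h := congrArg (eval z) (X_sub_one_mul_hatPhi (eta := eta) hq0 hq1 hlam k)
  simp only [eval_mul, eval_sub, eval_X, eval_C] at h
  have hz' : z - 1 ≠ 0 := sub_ne_zero.2 hz
  have hc := one_sub_pow_mul_qCos_ne_zero (eta := eta) hq0 hq1 hlam k
  have hk := qPoch_ne_zero hq0 hq1 (norm_qCos_lt_one (eta := eta) hq0 hq1 hlam) k
  have hB := qPoch_ne_zero hq0 hq1 (norm_cpow_bParam_lt_one (eta := eta) hq0 hq1 hlam) (k + 1)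
  refine mul_left_cancel₀ hz' (h.trans ?_)
  rw [modR_eq_eval hq0 hq1 hlam, modR_eq_eval hq0 hq1 hlam,
    qPoch_succ q (qCos q lam eta : ℂ) k, mul_comm (qCos q lam eta : ℂ)]
  generalize 1 - (q : ℂ) ^ k * (qCos q lam eta : ℂ) = w at hc ⊢
  field_simp

theorem verblunsky_hatPhi (hq0 : 0 < q) (hq1 : q < 1) (hlam : 0 < lam) (k : ℕ) :
    verblunsky (hatPhi q lam eta) k =
      -(1 - 2 * (minParam q lam eta (k + 1) : ℂ) *
          ((1 - (q : ℂ) ^ (k + 1) * (qCos q lam eta : ℂ)) /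
            (1 - (q : ℂ) ^ (conj (bParam lam eta) + ((k + 1 : ℕ) : ℂ))))) *
        (qPoch q ((q : ℂ) ^ bParam lam eta) (k + 1) /
          qPoch q ((q : ℂ) ^ conj (bParam lam eta)) (k + 1)) := by
  have h := congrArg (eval 0) (X_sub_one_mul_hatPhi (eta := eta) hq0 hq1 hlam (k + 1))
  have hB := norm_cpow_bParam_lt_one (eta := eta) hq0 hq1 hlam
  have hA : ‖conj ((q : ℂ) ^ bParam lam eta)‖ < 1 := by simpa using hB
  have hadd := cpow_bParam_add_conj (lam := lam) (eta := eta) hq0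
  simp only [eval_mul, eval_sub, eval_X, eval_C, eval_zero_selfRecip hq0 hq1] at h
  rw [qPoch_succ q _ (k + 1), qPoch_succ q _ (k + 1)] at h
  rw [verblunsky, cpow_conj_bParam_add_natCast hq0, conj_cpow_bParam hq0]
  have h' := congrArg conj h
  simp only [map_mul, map_sub, map_inv₀, conj_qPoch, Complex.conj_conj, map_one, map_zero,
    map_pow, Complex.conj_ofReal, map_ofNat] at h'
  have n1 := qPoch_ne_zero hq0 hq1 hA (k + 1)
  have n2 := one_sub_ne_zero_of_norm_lt_one (norm_mul_pow_lt_one hq0 hq1 hA (k + 1))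
  generalize (q : ℂ) ^ bParam lam eta = B at *
  generalize qPoch q (conj B) (k + 1) = P at *
  generalize qPoch q B (k + 1) = Q at *
  generalize conj B = A at *
  generalize (q : ℂ) ^ (k + 1) = u at *
  -- With `A = B̄`, `u = q^{k+1}` and `c = q^λ cos η_q`, this gives `1 - Bu - 2(1 - uc) = -(1 -
  -- Au)`, the source of the leading `1` in the bracket.
  have e : B = 2 * (qCos q lam eta : ℂ) - A := by linear_combination hadd
  rw [zero_sub, neg_one_mul] at h'
  rw [h', e]
  generalize hd : 1 - A * u = d at *
  field_simp
  rw [← hd]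
  ring

end HatMeasure

/-! ### The main theorem -/

theorem theorem1p1 (q lam eta : ℝ) (hq0 : 0 < q) (hq1 : q < 1) (hlam : 0 < lam)
    (rho : ℝ) (hrho : 0 < rho) :
    -- the recursion for `ℓ` never divides by zero, and `ℓ` (here `minParam k = ℓ_{k+1}`) is the
    -- minimal parameter sequence of the positive chain sequence `d_{k+1}`, `k ≥ 1`
    (minParam q lam eta 0 = 0 ∧
      ∀ k : ℕ, 1 ≤ k → 0 < minParam q lam eta k ∧ minParam q lam eta k < 1 ∧
        chainD q lam eta k = (1 - minParam q lam eta (k - 1)) * minParam q lam eta k) ∧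
    -- there is exactly one sequence of monic orthogonal polynomials
    ∃ Φ : ℕ → ℂ[X],
      IsMonicOPUC (hatMeasure q lam eta rho) Φ ∧
      (∀ Ψ : ℕ → ℂ[X], IsMonicOPUC (hatMeasure q lam eta rho) Ψ → Ψ = Φ) ∧
      -- explicit formula
      (∀ (k : ℕ) (z : ℂ), z ≠ 1 →
        (Φ k).eval z =
          qPoch q (qCos q lam eta : ℂ) (k + 1) / qPoch q ((q : ℂ) ^ bParam lam eta) (k + 1) *
            ((modR q lam eta (k + 1) z
              - 2 * (1 - (minParam q lam eta k : ℂ)) * modR q lam eta k z) / (z - 1))) ∧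
      -- Verblunsky coefficients
      (∀ k : ℕ, 1 ≤ k →
        verblunsky Φ (k - 1) =
          -(1 - 2 * (minParam q lam eta k : ℂ) *
              ((1 - (q : ℂ) ^ k * (qCos q lam eta : ℂ)) /
                (1 - (q : ℂ) ^ (conj (bParam lam eta) + (k : ℂ))))) *
            (qPoch q ((q : ℂ) ^ bParam lam eta) k /
              qPoch q ((q : ℂ) ^ conj (bParam lam eta)) k)) ∧
      -- normalisation constants
      (IsProbabilityMeasure (hatMeasure q lam eta rho) →
        ∃ κ : ℕ → ℝ, (∀ k, 0 < κ k) ∧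
          IsOrthonormalOPUC (hatMeasure q lam eta rho) (fun k => C (κ k : ℂ) * Φ k) ∧
          (∀ φ : ℕ → ℂ[X], IsOrthonormalOPUC (hatMeasure q lam eta rho) φ →
            φ = fun k => C (κ k : ℂ) * Φ k) ∧
          ∀ k : ℕ,
            (κ k : ℂ) ^ (-2 : ℤ) =
              qPoch q (q : ℂ) k * qPoch q ((q : ℂ) ^ (2 * (lam : ℂ))) k /
                (qPoch q ((q : ℂ) ^ (bParam lam eta + 1)) k *
                  qPoch q ((q : ℂ) ^ (conj (bParam lam eta) + 1)) k) *
                ((1 - (q : ℂ) ^ k * (qCos q lam eta : ℂ)) / (1 - (qCos q lam eta : ℂ))) *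
                (1 - (minParam q lam eta k : ℂ))) := by
  have hI := integrable_circleInner_hatMeasure (eta := eta) (rho := rho) hq0 hq1 hlam
  obtain ⟨hΦ, hself⟩ := hatPhi_isMonicOPUC (eta := eta) hq0 hq1 hlam hrho
  refine ⟨⟨rfl, fun k hk => ?_⟩, hatPhi q lam eta, hΦ, fun Ψ hΨ => IsMonicOPUC.unique hI hΦ hΨ,
    fun k z hz => eval_hatPhi hq0 hq1 hlam k hz, fun k hk => ?_, fun hprob => ?_⟩
  · obtain ⟨k, rfl⟩ := Nat.exists_eq_add_of_le' hk
    have h := sub_pos.2 (minParam_lt_one (eta := eta) hq0 hq1 hlam k)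
    refine ⟨div_pos (chainD_succ_pos hq0 hq1 hlam k) h, minParam_lt_one hq0 hq1 hlam _, ?_⟩
    rw [Nat.add_sub_cancel, minParam, mul_div_cancel₀ _ h.ne']
  · obtain ⟨k, rfl⟩ := Nat.exists_eq_add_of_le' hk
    exact verblunsky_hatPhi hq0 hq1 hlam k
  · obtain ⟨κ, hκ, ho, hu, hn⟩ := IsMonicOPUC.exists_orthonormal hI hΦ
    refine ⟨κ, hκ, ho, hu, fun k => ?_⟩
    -- Total mass one removes the factor `⟨1, 1⟩` from the norm formula.
    have hone : circleInner (hatMeasure q lam eta rho) 1 1 = 1 := by simp [circleInner]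
    rw [hn, hself, circleInner_X_pow_hatPhi_self hq0 hq1 hlam hrho, hone, one_mul]
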